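/- Let $\lambda>0$ and $0<L<\infty$, and let $X=\mathbb{R}\times L^1(0,L)$ (real scalars) with the norm $\|(p_0,p_1)\|_X=|p_0|+\|p_1\|_{L^1(0,L)}$ and with the positive cone of all $(p_0,p_1)$ such that $p_0\ge 0$ and $p_1\ge 0$ almost everywhere. Let $P^*=(p_0^*,p_1^*)\in X$ be a desired distribution, i.e. $p_0^*\ge 0$, $p_1^*\in W^{1,1}(0,L)$ (identified with its continuous representative on $[0,L]$), $$p_0^*+\int_0^L p_1^*(x)\,dx=1,\quad p_1^*(0)=\lambda p_0^*,\quad p_1^*(L)=0,\quad p_1^*(x)>0\ \text{ for all } x\in(0,L),\quad \frac{dp_1^*}{dx}<0\ \text{ a.e. in }(0,L),$$ and put $g=1/p_1^*$. Define the operator $\mathcal{A}$ on $X$ by $$\mathcal{A}\begin{pmatrix}p_0\\ p_1\end{pmatrix}=\begin{pmatrix}\displaystyle\int_0^L\frac{d}{dx}\bigl(g(x)p_1(x)\bigr)\,dx\\[2mm] \displaystyle-\frac{d}{dx}\bigl(g(x)p_1(x)\bigr)\end{pmatrix},\qquad D(\mathcal{A})=\bigl\{(p_0,p_1)\in X:\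 g\,p_1\in W^{1,1}(0,L),\ p_1(0)=\lambda p_0\bigr\},$$ where the derivative is the weak derivative and $p_1(0)$ is the value at $0$ of the continuous representative of $p_1$ on $[0,L]$, which exists when $gp_1\in W^{1,1}(0,L)$. Then $\mathcal{A}$ is the infinitesimal generator of a $C_0$-semigroup $T(t)$, $t\ge 0$, of bounded linear operators on $X$ that is positive ($T(t)$ maps the positive cone into itself for every $t\ge 0$) and contractive ($\|T(t)\|\le 1$ for every $t\ge 0$). -/

import Mathlib

open MeasureTheory Set Filter Topology
open scoped NNReal ContDiff

namespace RepairableSystem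

noncomputable section

/-! ### Weak derivatives and `W^{1,1}` on the interval `(0, L)` -/

/-- Lebesgue measure on the open interval `(0, L)`. -/
abbrev intervalMeasure (L : ℝ) : Measure ℝ := volume.restrict (Ioo 0 L)

/-- Smooth test functions with compact support contained in `(0, L)`. -/
structure IsTestFunction (L : ℝ) (φ : ℝ → ℝ) : Prop where
  smooth : ContDiff ℝ ∞ φ
  compact : HasCompactSupport φ
  support_subset : tsupport φ ⊆ Ioo 0 L

/-- `h` is a weak derivative of `f` on `(0, L)`: `∫ f φ' = - ∫ h φ` for all test functions. -/
def HasWeakDeriv (L : ℝ) (f h : ℝ → ℝ) : Prop :=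
  ∀ φ : ℝ → ℝ, IsTestFunction L φ →
    ∫ x, f x * deriv φ x ∂(intervalMeasure L) = - ∫ x, h x * φ x ∂(intervalMeasure L)

/-- `f ∈ W^{1,1}(0, L)`: both `f` and some weak derivative of `f` are integrable on `(0, L)`. -/
def MemW11 (L : ℝ) (f : ℝ → ℝ) : Prop :=
  Integrable f (intervalMeasure L) ∧
    ∃ h : ℝ → ℝ, Integrable h (intervalMeasure L) ∧ HasWeakDeriv L f h

open Classical in
/-- The integrable weak derivative of `f` (unique up to null sets; `0` if there is none). -/
def weakDeriv (L : ℝ) (f : ℝ → ℝ) : ℝ → ℝ :=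
  if H : ∃ h : ℝ → ℝ, Integrable h (intervalMeasure L) ∧ HasWeakDeriv L f h
  then H.choose else 0

/-- The continuous representative of (the class of) `f` on `[0, L]` takes the value `c` at `0`. -/
def HasValueAtZero (L : ℝ) (f : ℝ → ℝ) (c : ℝ) : Prop :=
  ∃ v : ℝ → ℝ, ContinuousOn v (Icc 0 L) ∧ f =ᵐ[intervalMeasure L] v ∧ v 0 = c

theorem IsTestFunction.integrable_mul {L : ℝ} {φ f : ℝ → ℝ} (hφ : IsTestFunction L φ)
    (hf : Integrable f (intervalMeasure L)) :
    Integrable (fun x => f x * φ x) (intervalMeasure L) := by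
  obtain ⟨C, hC⟩ := hφ.compact.exists_bound_of_continuous hφ.smooth.continuous
  exact hf.mul_bdd hφ.smooth.continuous.aestronglyMeasurable (Eventually.of_forall hC)

theorem IsTestFunction.integrable_mul_deriv {L : ℝ} {φ f : ℝ → ℝ} (hφ : IsTestFunction L φ)
    (hf : Integrable f (intervalMeasure L)) :
    Integrable (fun x => f x * deriv φ x) (intervalMeasure L) := by
  have hc : Continuous (deriv φ) := hφ.smooth.continuous_deriv (by simp)
  obtain ⟨C, hC⟩ := hφ.compact.deriv.exists_bound_of_continuous hc
  exact hf.mul_bdd hc.aestronglyMeasurable (Eventually.of_forall hC)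

theorem HasWeakDeriv.unique {L : ℝ} {f h k : ℝ → ℝ}
    (hh : Integrable h (intervalMeasure L)) (hk : Integrable k (intervalMeasure L))
    (H : HasWeakDeriv L f h) (K : HasWeakDeriv L f k) : h =ᵐ[intervalMeasure L] k := by
  have hd : IntegrableOn (fun x => h x - k x) (Ioo 0 L) volume := hh.sub hk
  have key := isOpen_Ioo.ae_eq_zero_of_integral_contDiff_smul_eq_zero
    hd.locallyIntegrableOn (fun φ hφ hc hs => by
      have hT : IsTestFunction L φ := ⟨hφ, hc, hs⟩
      have e : ∫ x, φ x • (h x - k x) ∂(intervalMeasure L) = 0 := by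
        have : ∀ x, φ x • (h x - k x) = h x * φ x - k x * φ x := fun x => by
          simp only [smul_eq_mul]; ring
        simp_rw [this]
        rw [integral_sub (hT.integrable_mul hh) (hT.integrable_mul hk)]
        have := H φ hT
        have := K φ hT
        linarith
      rw [← setIntegral_eq_integral_of_forall_compl_eq_zero (s := Ioo 0 L)]
      · exact e
      · intro x hx
        have : φ x = 0 := image_eq_zero_of_notMem_tsupport fun h' => hx (hs h')
        simp [this])
  rw [← ae_restrict_iff' measurableSet_Ioo] at key
  filter_upwards [key] with x hx
  linarith

theorem HasWeakDeriv.congr {L : ℝ} {f f' h : ℝ → ℝ} (e : f =ᵐ[intervalMeasure L] f')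
    (H : HasWeakDeriv L f h) : HasWeakDeriv L f' h := fun φ hφ => by
  rw [← H φ hφ]
  refine integral_congr_ae ?_
  filter_upwards [e] with x hx
  rw [hx]

theorem HasWeakDeriv.add {L : ℝ} {f f' h h' : ℝ → ℝ}
    (hf : Integrable f (intervalMeasure L)) (hf' : Integrable f' (intervalMeasure L))
    (hh : Integrable h (intervalMeasure L)) (hh' : Integrable h' (intervalMeasure L))
    (H : HasWeakDeriv L f h) (H' : HasWeakDeriv L f' h') :
    HasWeakDeriv L (f + f') (h + h') := fun φ hφ => by
  simp only [Pi.add_apply, add_mul]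
  rw [integral_add (hφ.integrable_mul_deriv hf) (hφ.integrable_mul_deriv hf'),
    integral_add (hφ.integrable_mul hh) (hφ.integrable_mul hh'), H φ hφ, H' φ hφ]
  ring

theorem HasWeakDeriv.smul {L : ℝ} {f h : ℝ → ℝ} (c : ℝ) (H : HasWeakDeriv L f h) :
    HasWeakDeriv L (c • f) (c • h) := fun φ hφ => by
  simp only [Pi.smul_apply, smul_eq_mul, mul_assoc]
  rw [integral_const_mul, integral_const_mul, H φ hφ]
  ring

theorem integrable_weakDeriv (L : ℝ) (f : ℝ → ℝ) :
    Integrable (weakDeriv L f) (intervalMeasure L) := by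
  unfold weakDeriv
  split_ifs with H
  · exact H.choose_spec.1
  · exact integrable_zero _ _ _

theorem MemW11.hasWeakDeriv {L : ℝ} {f : ℝ → ℝ} (hf : MemW11 L f) :
    HasWeakDeriv L f (weakDeriv L f) := by
  unfold weakDeriv
  rw [dif_pos hf.2]
  exact hf.2.choose_spec.2

theorem HasWeakDeriv.weakDeriv_ae_eq {L : ℝ} {f h : ℝ → ℝ} (hf : Integrable f (intervalMeasure L))
    (hh : Integrable h (intervalMeasure L)) (H : HasWeakDeriv L f h) :
    weakDeriv L f =ᵐ[intervalMeasure L] h :=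
  HasWeakDeriv.unique (integrable_weakDeriv L f) hh
    (MemW11.hasWeakDeriv ⟨hf, h, hh, H⟩) H

theorem MemW11.congr {L : ℝ} {f f' : ℝ → ℝ} (e : f =ᵐ[intervalMeasure L] f')
    (hf : MemW11 L f) : MemW11 L f' :=
  ⟨hf.1.congr e, hf.2.choose, hf.2.choose_spec.1, hf.2.choose_spec.2.congr e⟩

theorem MemW11.add {L : ℝ} {f f' : ℝ → ℝ} (hf : MemW11 L f) (hf' : MemW11 L f') :
    MemW11 L (f + f') :=
  ⟨hf.1.add hf'.1, _, (integrable_weakDeriv L f).add (integrable_weakDeriv L f'),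
    hf.hasWeakDeriv.add hf.1 hf'.1 (integrable_weakDeriv L f) (integrable_weakDeriv L f')
      hf'.hasWeakDeriv⟩

theorem MemW11.smul {L : ℝ} {f : ℝ → ℝ} (c : ℝ) (hf : MemW11 L f) : MemW11 L (c • f) :=
  ⟨hf.1.smul c, _, (integrable_weakDeriv L f).smul c, hf.hasWeakDeriv.smul c⟩

theorem weakDeriv_add {L : ℝ} {f f' s : ℝ → ℝ} (hf : MemW11 L f) (hf' : MemW11 L f')
    (e : s =ᵐ[intervalMeasure L] f + f') :
    weakDeriv L s =ᵐ[intervalMeasure L] weakDeriv L f + weakDeriv L f' :=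
  ((hf.hasWeakDeriv.add hf.1 hf'.1 (integrable_weakDeriv L f) (integrable_weakDeriv L f')
    hf'.hasWeakDeriv).congr e.symm).weakDeriv_ae_eq ((hf.1.add hf'.1).congr e.symm)
      ((integrable_weakDeriv L f).add (integrable_weakDeriv L f'))

theorem weakDeriv_smul {L : ℝ} {f s : ℝ → ℝ} (c : ℝ) (hf : MemW11 L f)
    (e : s =ᵐ[intervalMeasure L] c • f) :
    weakDeriv L s =ᵐ[intervalMeasure L] c • weakDeriv L f :=
  ((hf.hasWeakDeriv.smul c).congr e.symm).weakDeriv_ae_eq ((hf.1.smul c).congr e.symm)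
      ((integrable_weakDeriv L f).smul c)

/-! ### The state space and the desired distribution -/

/-- `X = ℝ × L¹(0, L)` with the norm `‖(p₀, p₁)‖ = |p₀| + ‖p₁‖_{L¹}`. -/
abbrev StateSpace (L : ℝ) : Type := WithLp 1 (ℝ × Lp ℝ 1 (intervalMeasure L))

/-- The positive cone of `X`: `p₀ ≥ 0` and `p₁ ≥ 0` almost everywhere. -/
def StateNonneg {L : ℝ} (P : StateSpace L) : Prop := 0 ≤ P.fst ∧ 0 ≤ P.snd

/-- `(p₀*, p₁*)` is an admissible desired distribution for failure rate `lam`; `p₁*` is given by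
its continuous representative on `[0, L]`. -/
structure IsDesiredState (lam L p₀s : ℝ) (p₁s : ℝ → ℝ) : Prop where
  nonneg : 0 ≤ p₀s
  memW11 : MemW11 L p₁s
  continuousOn : ContinuousOn p₁s (Icc 0 L)
  mass : p₀s + ∫ x, p₁s x ∂(intervalMeasure L) = 1
  left_value : p₁s 0 = lam * p₀s
  right_value : p₁s L = 0
  pos : ∀ x ∈ Ioo 0 L, 0 < p₁s x
  deriv_neg : ∀ᵐ x ∂(intervalMeasure L), weakDeriv L p₁s x < 0

/-! ### The closed-loop operator -/

/-- The function `g p₁`, with `g = 1 / p₁*`. -/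
def weighted {L : ℝ} (p₁s : ℝ → ℝ) (P : StateSpace L) : ℝ → ℝ :=
  fun x => (1 / p₁s x) * P.snd x

theorem weighted_add {L : ℝ} (p₁s : ℝ → ℝ) (P Q : StateSpace L) :
    weighted p₁s (P + Q) =ᵐ[intervalMeasure L] weighted p₁s P + weighted p₁s Q := by
  filter_upwards [Lp.coeFn_add P.snd Q.snd] with x hx
  simp only [weighted, WithLp.add_snd, Pi.add_apply, hx]
  ring

theorem weighted_smul {L : ℝ} (p₁s : ℝ → ℝ) (c : ℝ) (P : StateSpace L) :
    weighted p₁s (c • P) =ᵐ[intervalMeasure L] c • weighted p₁s P := by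
  filter_upwards [Lp.coeFn_smul c P.snd] with x hx
  simp only [weighted, WithLp.smul_snd, Pi.smul_apply, hx, smul_eq_mul]
  ring

/-- `D(𝒜) = {P ∈ X | g p₁ ∈ W^{1,1}(0, L), p₁(0) = lam p₀}`. -/
def closedLoopDomain (lam L : ℝ) (p₁s : ℝ → ℝ) : Submodule ℝ (StateSpace L) where
  carrier := {P | MemW11 L (weighted p₁s P) ∧ HasValueAtZero L P.snd (lam * P.fst)}
  zero_mem' := by
    have e : ((0 : StateSpace L).snd : ℝ → ℝ) =ᵐ[intervalMeasure L] fun _ => 0 :=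
      Lp.coeFn_zero ℝ 1 (intervalMeasure L)
    refine ⟨?_, fun _ => 0, continuousOn_const, e, by simp⟩
    have e' : (fun _ => 0 : ℝ → ℝ) =ᵐ[intervalMeasure L] weighted p₁s (0 : StateSpace L) := by
      filter_upwards [e] with x hx
      change (0 : ℝ) = (1 / p₁s x) * ((0 : StateSpace L).snd : ℝ → ℝ) x
      rw [hx, mul_zero]
    refine MemW11.congr e' ⟨integrable_zero _ _ _, fun _ => 0, integrable_zero _ _ _, ?_⟩
    intro φ _
    simp
  add_mem' := by
    rintro P Q ⟨hP, v, hv, ev, v0⟩ ⟨hQ, w, hw, ew, w0⟩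
    refine ⟨(hP.add hQ).congr (weighted_add p₁s P Q).symm, v + w, hv.add hw, ?_, ?_⟩
    · exact (Lp.coeFn_add P.snd Q.snd).trans (ev.add ew)
    · simp [v0, w0, mul_add]
  smul_mem' := by
    rintro c P ⟨hP, v, hv, ev, v0⟩
    refine ⟨(hP.smul c).congr (weighted_smul p₁s c P).symm, c • v, hv.const_smul c, ?_, ?_⟩
    · exact (Lp.coeFn_smul c P.snd).trans (ev.const_smul c)
    · simp [v0, mul_left_comm]

/-- The closed-loop operator `𝒜 (p₀, p₁) = (∫₀ᴸ (g p₁)' dx, -(g p₁)')` on `D(𝒜)`. -/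
def closedLoopOperator (lam L : ℝ) (p₁s : ℝ → ℝ) : StateSpace L →ₗ.[ℝ] StateSpace L where
  domain := closedLoopDomain lam L p₁s
  toFun :=
    { toFun := fun P => WithLp.toLp 1
        (∫ x, weakDeriv L (weighted p₁s P.1) x ∂(intervalMeasure L),
          -(integrable_weakDeriv L (weighted p₁s P.1)).toL1)
      map_add' := by
        rintro ⟨P, hP⟩ ⟨Q, hQ⟩
        have e := weakDeriv_add hP.1 hQ.1 (weighted_add p₁s P Q)
        have iP := integrable_weakDeriv L (weighted p₁s P)
        have iQ := integrable_weakDeriv L (weighted p₁s Q)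
        have e1 : ∫ x, weakDeriv L (weighted p₁s (P + Q)) x ∂(intervalMeasure L) =
            ∫ x, weakDeriv L (weighted p₁s P) x ∂(intervalMeasure L) +
              ∫ x, weakDeriv L (weighted p₁s Q) x ∂(intervalMeasure L) := by
          rw [integral_congr_ae e]
          exact integral_add iP iQ
        have e2 : (integrable_weakDeriv L (weighted p₁s (P + Q))).toL1 =
            iP.toL1 + iQ.toL1 := by
          rw [← Integrable.toL1_add _ _ iP iQ, Integrable.toL1_eq_toL1_iff]
          exact e
        rw [← WithLp.toLp_add, Prod.mk_add_mk, ← neg_add]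
        exact congrArg (WithLp.toLp 1) (Prod.ext e1 (congrArg Neg.neg e2))
      map_smul' := by
        rintro c ⟨P, hP⟩
        have e := weakDeriv_smul c hP.1 (weighted_smul p₁s c P)
        have iP := integrable_weakDeriv L (weighted p₁s P)
        have e1 : ∫ x, weakDeriv L (weighted p₁s (c • P)) x ∂(intervalMeasure L) =
            c * ∫ x, weakDeriv L (weighted p₁s P) x ∂(intervalMeasure L) := by
          rw [integral_congr_ae e]
          exact integral_const_mul c _
        have e2 : (integrable_weakDeriv L (weighted p₁s (c • P))).toL1 = c • iP.toL1 := by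
          rw [← Integrable.toL1_smul' _ iP, Integrable.toL1_eq_toL1_iff]
          exact e
        rw [RingHom.id_apply, ← WithLp.toLp_smul, Prod.smul_mk, smul_neg]
        exact congrArg (WithLp.toLp 1) (Prod.ext e1 (congrArg Neg.neg e2)) }

/-! ### Strongly continuous semigroups -/

/-- `T` is a `C₀`-semigroup of bounded operators on the real Banach space `E`. -/
structure IsC0Semigroup {E : Type*} [NormedAddCommGroup E] [NormedSpace ℝ E]
    (T : ℝ≥0 → E →L[ℝ] E) : Prop where
  map_zero : T 0 = ContinuousLinearMap.id ℝ E
  map_add : ∀ s t, T (s + t) = (T s).comp (T t)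
  tendsto_zero : ∀ x, Tendsto (fun t => T t x) (𝓝[>] 0) (𝓝 x)

/-- `A` generates `T`: `T` is a `C₀`-semigroup, and its infinitesimal generator, whose graph is
the set of `(x, y)` with `(T t x - x) / t → y` as `t → 0⁺`, is exactly `A` (domain included). -/
def Generates {E : Type*} [NormedAddCommGroup E] [NormedSpace ℝ E]
    (A : E →ₗ.[ℝ] E) (T : ℝ≥0 → E →L[ℝ] E) : Prop :=
  IsC0Semigroup T ∧ ∀ x y : E, (x, y) ∈ A.graph ↔
    Tendsto (fun t : ℝ≥0 => (t : ℝ)⁻¹ • (T t x - x)) (𝓝[>] 0) (𝓝 y)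

end

end RepairableSystem

/-!
Writing `u = p₁ / p₁*`, the weak form of the domain says that `u` is absolutely continuous on `[0, L]`
and that `p₀ = p₀* u(0)`; then `𝒜 (p₀, p₁) = (u(L) - u(0), -u')`. This is
`IsDesiredState.mem_graph_iff`, which rests on the fact that a function with integrable weak
derivative is a primitive of it (`HasWeakDeriv.exists_ae_eq_primitive`). The monotonicity of `p₁*`
is used only to see that `p₀* > 0`.

For `μ > 0` the equation `(μ - 𝒜) P = F` is the linear equation `u' + μ p₁* u = f₁` with the boundary
condition `μ p₀* u(0) - u(L) + u(0) = f₀`. The integrating factor `exp (μ ∫₀ˣ p₁*)` solves it for every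
`F` (`IsDesiredState.exists_resolvent_solution`) and shows that `P ≥ 0` when `F ≥ 0`
(`IsDesiredState.stateNonneg_of_resolvent`). The two components of `𝒜 P` have opposite integrals, so
`μ ‖P‖ = ‖F‖` for `F ≥ 0`; since the solution for the data `|F|` dominates the one for `F`, the operator
is dissipative (`dissipative_of_positive`). The domain is dense because `X` is `L¹` of the finite
measure `p₀* δ₀ + p₁* dx`, in which polynomials are dense (`IsDesiredState.dense_domain`).

The semigroup then comes from the Lumer–Phillips theorem (`exists_generates_of_dissipative`), proved
here through the Yosida approximations `μ (μ R(μ) - 1)`: their exponentials are contractions, they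
are positive since `exp (-μ t) exp (μ² t R(μ))` is, and they converge strongly. That the generator of
the limit extends `𝒜` follows from a Taylor estimate that is uniform in `μ`, and equality holds because
`1 - 𝒜` is onto while `1 - B` is injective for the generator `B` of a contraction semigroup.
-/

namespace RepairableSystem

/-! ### Exponentials of bounded operators -/

section BoundedGenerator

variable {E : Type*} [NormedAddCommGroup E] [NormedSpace ℝ E] [CompleteSpace E]

theorem norm_exp_le_exp_norm (B : E →L[ℝ] E) : ‖NormedSpace.exp B‖ ≤ Real.exp ‖B‖ := by
  have h1 := NormedSpace.exp_series_hasSum_exp' (𝕂 := ℝ) B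
  have h2 := NormedSpace.exp_series_hasSum_exp' (𝕂 := ℝ) ‖B‖
  rw [← Real.exp_eq_exp_ℝ] at h2
  rw [← h1.tsum_eq]
  refine tsum_of_norm_bounded h2 fun n => ?_
  rw [norm_smul, Real.norm_of_nonneg (by positivity), smul_eq_mul]
  refine mul_le_mul_of_nonneg_left ?_ (by positivity)
  rcases Nat.eq_zero_or_pos n with rfl | hn
  · simpa using! ContinuousLinearMap.norm_id_le
  · exact norm_pow_le' B hn

/-- The exponential of an operator preserving a closed convex cone preserves that cone. -/
theorem exp_apply_mem_of_mapsTo {K : Set E} (hK : IsClosed K) (h0 : (0 : E) ∈ K)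
    (hadd : ∀ x ∈ K, ∀ y ∈ K, x + y ∈ K) (hsmul : ∀ c : ℝ, 0 ≤ c → ∀ x ∈ K, c • x ∈ K)
    {B : E →L[ℝ] E} (hB : ∀ x ∈ K, B x ∈ K) {x : E} (hx : x ∈ K) :
    NormedSpace.exp B x ∈ K := by
  have h1 := (NormedSpace.exp_series_hasSum_exp' (𝕂 := ℝ) B).mapL
    (ContinuousLinearMap.apply ℝ E x)
  have hpow : ∀ n : ℕ, (B ^ n) x ∈ K := by
    intro n
    induction n with
    | zero => simpa using hx
    | succ n ih => rw [pow_succ']; exact hB _ ih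
  refine hK.mem_of_tendsto h1 (Eventually.of_forall fun s => ?_)
  refine Finset.sum_induction _ (· ∈ K) (fun a b ha hb => hadd a ha b hb) h0 fun n _ => ?_
  exact hsmul _ (by positivity) _ (hpow n)

theorem exp_add_smul_one (B : E →L[ℝ] E) (c : ℝ) :
    NormedSpace.exp (B + c • (1 : E →L[ℝ] E)) = Real.exp c • NormedSpace.exp B := by
  let _ : NormedAlgebra ℚ (E →L[ℝ] E) := NormedAlgebra.restrictScalars ℚ ℝ _
  have h := NormedSpace.algebraMap_exp_comm (𝕂 := ℝ) (𝔸 := E →L[ℝ] E) c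
  rw [Algebra.algebraMap_eq_smul_one, Algebra.algebraMap_eq_smul_one] at h
  rw [NormedSpace.exp_add_of_commute ((Commute.one_right B).smul_right c), ← h,
    ← Real.exp_eq_exp_ℝ, mul_smul_comm, mul_one]

theorem hasDerivAt_exp_smul_apply (B : E →L[ℝ] E) (x : E) (t : ℝ) :
    HasDerivAt (fun s : ℝ => NormedSpace.exp (s • B) x) (NormedSpace.exp (t • B) (B x)) t := by
  have := (hasDerivAt_exp_smul_const (𝕂 := ℝ) B t).clm_apply (hasDerivAt_const t x)
  simpa using this

/-- Two commuting bounded generators of contraction semigroups: the semigroups differ at time `t`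
by at most `t` times the difference of the generators. -/
theorem norm_exp_smul_sub_exp_smul_le {B C : E →L[ℝ] E} (hBC : Commute B C)
    (hB : ∀ t : ℝ, 0 ≤ t → ‖NormedSpace.exp (t • B)‖ ≤ 1)
    (hC : ∀ t : ℝ, 0 ≤ t → ‖NormedSpace.exp (t • C)‖ ≤ 1) {t : ℝ} (ht : 0 ≤ t) (x : E) :
    ‖NormedSpace.exp (t • B) x - NormedSpace.exp (t • C) x‖ ≤ t * ‖B x - C x‖ := by
  have hd : ∀ s : ℝ, HasDerivAt
      (fun s : ℝ => NormedSpace.exp (s • B) (NormedSpace.exp ((t - s) • C) x))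
      (NormedSpace.exp (s • B) (NormedSpace.exp ((t - s) • C) (B x - C x))) s := by
    intro s
    have h1 := hasDerivAt_exp_smul_const (𝕂 := ℝ) B s
    have h2 := (hasDerivAt_exp_smul_apply C x (t - s)).scomp s ((hasDerivAt_id s).const_sub t)
    have h3 := h1.clm_apply h2
    convert! h3 using 1
    have hc : B (NormedSpace.exp ((t - s) • C) x) = NormedSpace.exp ((t - s) • C) (B x) := by
      let _ : NormedAlgebra ℚ (E →L[ℝ] E) := NormedAlgebra.restrictScalars ℚ ℝ _
      exact congrArg (fun F : E →L[ℝ] E => F x)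
        ((hBC.smul_right (t - s)).exp_right.eq)
    rw [map_sub, ← hc]
    simp [sub_eq_add_neg]
  have := norm_image_sub_le_of_norm_deriv_le_segment' (a := 0) (b := t) (C := ‖B x - C x‖)
    (fun s _ => (hd s).hasDerivWithinAt) (fun s hs => ?_) t ⟨ht, le_rfl⟩
  · simpa [mul_comm] using this
  · refine (ContinuousLinearMap.le_of_opNorm_le _ (hB s hs.1) _).trans ?_
    rw [one_mul]
    refine (ContinuousLinearMap.le_of_opNorm_le _ (hC (t - s) (by linarith [hs.2])) _).trans ?_
    rw [one_mul]

theorem norm_exp_smul_sub_self_le {B : E →L[ℝ] E}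
    (hB : ∀ t : ℝ, 0 ≤ t → ‖NormedSpace.exp (t • B)‖ ≤ 1) {t : ℝ} (ht : 0 ≤ t) (x : E) :
    ‖NormedSpace.exp (t • B) x - x‖ ≤ t * ‖B x‖ := by
  have h := norm_exp_smul_sub_exp_smul_le (Commute.zero_right B) hB
    (fun t _ => by simpa using! ContinuousLinearMap.norm_id_le) ht x
  simpa using h

/-- First order Taylor estimate for a contraction semigroup with bounded generator `B`. The bound
involves `B` only through `B x` and `B z`, which keeps it uniform along Yosida approximations. -/
theorem norm_exp_smul_sub_self_sub_le {B : E →L[ℝ] E}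
    (hB : ∀ t : ℝ, 0 ≤ t → ‖NormedSpace.exp (t • B)‖ ≤ 1) {t : ℝ} (ht : 0 ≤ t) (x z : E) :
    ‖NormedSpace.exp (t • B) x - x - t • B x‖ ≤ t * (2 * ‖B x - z‖ + t * ‖B z‖) := by
  have hd : ∀ s : ℝ, HasDerivAt (fun s : ℝ => NormedSpace.exp (s • B) x - s • B x)
      (NormedSpace.exp (s • B) (B x) - B x) s := fun s => by
    have := (hasDerivAt_exp_smul_apply B x s).sub ((hasDerivAt_id s).smul_const (B x))
    simpa using! this
  have := norm_image_sub_le_of_norm_deriv_le_segment' (a := 0) (b := t)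
    (C := 2 * ‖B x - z‖ + t * ‖B z‖)
    (fun s _ => (hd s).hasDerivWithinAt) (fun s hs => ?_) t ⟨ht, le_rfl⟩
  · have e : NormedSpace.exp (t • B) x - x - t • B x =
        NormedSpace.exp (t • B) x - t • B x - (NormedSpace.exp ((0 : ℝ) • B) x - (0 : ℝ) • B x) := by
      simp only [zero_smul, NormedSpace.exp_zero, one_apply_eq_self, sub_zero]
      abel
    rw [e]
    simpa [mul_comm] using this
  · have e : NormedSpace.exp (s • B) (B x) - B x =
        NormedSpace.exp (s • B) (B x - z) - (B x - z) + (NormedSpace.exp (s • B) z - z) := by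
      rw [map_sub]; abel
    rw [e]
    have h1 := ContinuousLinearMap.le_of_opNorm_le _ (hB s hs.1) (B x - z)
    have h2 := norm_exp_smul_sub_self_le hB hs.1 z
    have h3 : s * ‖B z‖ ≤ t * ‖B z‖ := mul_le_mul_of_nonneg_right hs.2.le (norm_nonneg _)
    have h4 := norm_add_le (NormedSpace.exp (s • B) (B x - z) - (B x - z))
      (NormedSpace.exp (s • B) z - z)
    have h5 := norm_sub_le (NormedSpace.exp (s • B) (B x - z)) (B x - z)
    linarith

end BoundedGenerator

/-! ### Generation of positive contraction semigroups -/

section LumerPhillips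

variable {E : Type*} [NormedAddCommGroup E] [NormedSpace ℝ E]

/-- `R` is the resolvent `(μ - A)⁻¹`. -/
def IsResolvent (A : E →ₗ.[ℝ] E) (μ : ℝ) (R : E →L[ℝ] E) : Prop :=
  ∀ x y : E, R y = x ↔ (x, μ • x - y) ∈ A.graph

theorem exists_isResolvent {A : E →ₗ.[ℝ] E} {μ : ℝ} (hμ : 0 < μ)
    (hdiss : ∀ p ∈ A.graph, μ * ‖p.1‖ ≤ ‖μ • p.1 - p.2‖)
    (hsurj : ∀ y, ∃ x, (x, μ • x - y) ∈ A.graph) :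
    ∃ R : E →L[ℝ] E, IsResolvent A μ R ∧ ‖R‖ ≤ μ⁻¹ := by
  have huniq : ∀ x x' y, (x, μ • x - y) ∈ A.graph → (x', μ • x' - y) ∈ A.graph → x = x' := by
    intro x x' y h h'
    have h1 := hdiss _ (A.graph.sub_mem h h')
    have e : μ • (x - x') - (μ • x - y - (μ • x' - y)) = 0 := by rw [smul_sub]; abel
    simp only [Prod.mk_sub_mk, e, norm_zero] at h1
    have h2 : ‖x - x'‖ ≤ 0 := by
      by_contra hlt
      exact absurd (mul_pos hμ (not_le.1 hlt)) (not_lt.2 h1)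
    exact sub_eq_zero.1 (norm_le_zero_iff.1 h2)
  choose r hr using hsurj
  let R₀ : E →ₗ[ℝ] E :=
    { toFun := r
      map_add' := fun y z => huniq _ _ (y + z) (hr _) (by
        convert! A.graph.add_mem (hr y) (hr z) using 2
        simp only [Prod.snd_add, smul_add]
        abel)
      map_smul' := fun c y => huniq _ _ (c • y) (hr _) (by
        convert! A.graph.smul_mem c (hr y) using 2
        simp only [RingHom.id_apply, Prod.smul_snd, smul_sub]
        rw [smul_comm]) }
  refine ⟨R₀.mkContinuous μ⁻¹ fun y => ?_, fun x y => ⟨?_, fun h => huniq _ _ y (hr y) h⟩,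
    R₀.mkContinuous_norm_le (inv_nonneg.2 hμ.le) _⟩
  · have h := hdiss _ (hr y)
    simp only [sub_sub_cancel] at h
    rwa [inv_mul_eq_div, le_div_iff₀ hμ, mul_comm]
  · rintro rfl
    exact hr y

namespace IsResolvent

variable {A : E →ₗ.[ℝ] E} {μ ν : ℝ} {R S : E →L[ℝ] E}

theorem mem_graph (hR : IsResolvent A μ R) (y : E) : (R y, μ • R y - y) ∈ A.graph :=
  (hR _ _).1 rfl

theorem apply_smul_sub (hR : IsResolvent A μ R) {x y : E} (h : (x, y) ∈ A.graph) :
    μ • R x - x = R y := by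
  have : R (μ • x - y) = x := (hR _ _).2 (by rwa [sub_sub_cancel])
  rw [map_sub, map_smul] at this
  rw [← sub_eq_zero, sub_right_comm, this, sub_self]

/-- The resolvent identity `R(μ) - R(ν) = (ν - μ) R(μ) R(ν)`. -/
theorem sub_eq (hR : IsResolvent A μ R) (hS : IsResolvent A ν S) :
    R - S = (ν - μ) • (R * S) := by
  ext y
  have h := hR.apply_smul_sub (hS.mem_graph y)
  rw [map_sub, map_smul] at h
  simp only [sub_apply, smul_apply, mul_apply_eq_comp, sub_smul]
  rw [sub_eq_sub_iff_add_eq_add] at h ⊢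
  rw [add_comm, h]

theorem commute (hR : IsResolvent A μ R) (hS : IsResolvent A ν S) : Commute R S := by
  rcases eq_or_ne μ ν with rfl | hne
  · have : R = S := sub_eq_zero.1 (by rw [hR.sub_eq hS, sub_self, zero_smul])
    rw [this]
  · have h1 := hR.sub_eq hS
    have h2 := hS.sub_eq hR
    have h3 : (ν - μ) • (R * S) = (ν - μ) • (S * R) := by
      rw [← h1, ← neg_sub, h2, ← neg_smul, neg_sub]
    exact smul_right_injective _ (sub_ne_zero.2 hne.symm) h3

end IsResolvent

/-- The Yosida approximation `μ (μ R - 1) = μ A R` built from a resolvent `R` at `μ`. -/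
noncomputable def yosida (μ : ℝ) (R : E →L[ℝ] E) : E →L[ℝ] E := μ • (μ • R - 1)

theorem yosida_apply_of_mem_graph {A : E →ₗ.[ℝ] E} {μ : ℝ} {R : E →L[ℝ] E}
    (hR : IsResolvent A μ R) {x y : E} (h : (x, y) ∈ A.graph) : yosida μ R x = μ • R y := by
  simp [yosida, ← hR.apply_smul_sub h]

theorem commute_yosida {μ ν : ℝ} {R S : E →L[ℝ] E} (h : Commute R S) :
    Commute (yosida μ R) (yosida ν S) :=
  ((((h.smul_left μ).smul_right ν).sub_right (Commute.one_right _)).sub_left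
    (Commute.one_left _)).smul_left μ |>.smul_right ν

theorem exp_smul_yosida [CompleteSpace E] (t μ : ℝ) (R : E →L[ℝ] E) :
    NormedSpace.exp (t • yosida μ R) =
      Real.exp (-(t * μ)) • NormedSpace.exp ((t * μ ^ 2) • R) := by
  rw [← exp_add_smul_one]
  congr 1
  simp only [yosida, smul_sub, smul_smul, neg_smul, ← sub_eq_add_neg]
  ring_nf

theorem norm_exp_smul_yosida_le [CompleteSpace E] {μ : ℝ} (hμ : 0 < μ) {R : E →L[ℝ] E}
    (hR : ‖R‖ ≤ μ⁻¹) {t : ℝ} (ht : 0 ≤ t) : ‖NormedSpace.exp (t • yosida μ R)‖ ≤ 1 := by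
  rw [exp_smul_yosida, norm_smul, Real.norm_of_nonneg (Real.exp_nonneg _)]
  have h1 : ‖(t * μ ^ 2) • R‖ ≤ t * μ := by
    rw [norm_smul, Real.norm_of_nonneg (by positivity)]
    calc t * μ ^ 2 * ‖R‖ ≤ t * μ ^ 2 * μ⁻¹ := by gcongr
      _ = t * μ := by field_simp
  calc _ ≤ Real.exp (-(t * μ)) * Real.exp (t * μ) := by
        gcongr
        exact (norm_exp_le_exp_norm _).trans (Real.exp_le_exp.2 h1)
    _ = 1 := by rw [← Real.exp_add, neg_add_cancel, Real.exp_zero]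

/-- For contractive approximate resolvents, `μ R(μ) → 1` strongly. -/
theorem tendsto_smul_resolvent {A : E →ₗ.[ℝ] E} (hdense : Dense (A.domain : Set E))
    {μ : ℕ → ℝ} (hμ : ∀ n, 0 < μ n) (hμ' : Tendsto μ atTop atTop) {R : ℕ → E →L[ℝ] E}
    (hR : ∀ n, IsResolvent A (μ n) (R n)) (hR' : ∀ n, ‖R n‖ ≤ (μ n)⁻¹) (y : E) :
    Tendsto (fun n => μ n • R n y) atTop (𝓝 y) := by
  have hle : ∀ n z, ‖μ n • R n z‖ ≤ ‖z‖ := fun n z => by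
    rw [norm_smul, Real.norm_of_nonneg (hμ n).le]
    calc μ n * ‖R n z‖ ≤ μ n * ((μ n)⁻¹ * ‖z‖) := by
          gcongr
          · exact (hμ n).le
          · exact ContinuousLinearMap.le_of_opNorm_le _ (hR' n) z
      _ = ‖z‖ := by rw [mul_inv_cancel_left₀ (hμ n).ne']
  rw [Metric.tendsto_atTop]
  intro ε hε
  obtain ⟨z, hz, hyz⟩ := Metric.dense_iff.1 hdense y (ε / 3) (by positivity)
  rw [Metric.mem_ball, dist_eq_norm, norm_sub_rev] at hz
  obtain ⟨w, hw⟩ := LinearPMap.mem_domain_iff.1 hyz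
  have h0 : Tendsto (fun n => (μ n)⁻¹ * ‖w‖) atTop (𝓝 (0 * ‖w‖)) :=
    hμ'.inv_tendsto_atTop.mul_const _
  rw [zero_mul] at h0
  obtain ⟨N, hN⟩ := eventually_atTop.1 (h0.eventually (gt_mem_nhds (show 0 < ε / 3 by positivity)))
  refine ⟨N, fun n hn => ?_⟩
  have h1 := hle n (y - z)
  have h2 : ‖μ n • R n z - z‖ < ε / 3 := by
    rw [(hR n).apply_smul_sub hw]
    exact (ContinuousLinearMap.le_of_opNorm_le _ (hR' n) w).trans_lt (hN n hn)
  have e : μ n • R n y - y = μ n • R n (y - z) + (μ n • R n z - z) - (y - z) := by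
    rw [map_sub, smul_sub]; abel
  rw [dist_eq_norm, e]
  have h3 := norm_sub_le (μ n • R n (y - z) + (μ n • R n z - z)) (y - z)
  have h4 := norm_add_le (μ n • R n (y - z)) (μ n • R n z - z)
  linarith

/-- The exponentials of the Yosida approximations converge strongly to contractions. -/
theorem exists_tendsto_exp_yosida [CompleteSpace E] {A : E →ₗ.[ℝ] E}
    (hdense : Dense (A.domain : Set E)) {Y : ℕ → E →L[ℝ] E}
    (hY : ∀ n, ∀ t : ℝ, 0 ≤ t → ‖NormedSpace.exp (t • Y n)‖ ≤ 1)
    (hcomm : ∀ m n, Commute (Y m) (Y n))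
    (hlim : ∀ p ∈ A.graph, Tendsto (fun n => Y n p.1) atTop (𝓝 p.2)) (t : ℝ) (ht : 0 ≤ t) :
    ∃ T : E →L[ℝ] E, ‖T‖ ≤ 1 ∧
      ∀ x, Tendsto (fun n => NormedSpace.exp (t • Y n) x) atTop (𝓝 (T x)) := by
  have hle : ∀ n x, ‖NormedSpace.exp (t • Y n) x‖ ≤ ‖x‖ := fun n x => by
    simpa using ContinuousLinearMap.le_of_opNorm_le _ (hY n t ht) x
  have hex : ∀ x, ∃ y, Tendsto (fun n => NormedSpace.exp (t • Y n) x) atTop (𝓝 y) := by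
    intro x
    refine cauchySeq_tendsto_of_complete (Metric.cauchySeq_iff.2 fun ε hε => ?_)
    obtain ⟨z, hz, hxz⟩ := Metric.dense_iff.1 hdense x (ε / 3) (by positivity)
    rw [Metric.mem_ball, dist_eq_norm, norm_sub_rev] at hz
    obtain ⟨w, hw⟩ := LinearPMap.mem_domain_iff.1 hxz
    obtain ⟨N, hN⟩ := Metric.cauchySeq_iff.1 (hlim _ hw).cauchySeq (ε / (3 * (t + 1)))
      (by positivity)
    refine ⟨N, fun m hm n hn => ?_⟩
    have h1 := norm_exp_smul_sub_exp_smul_le (hcomm m n) (hY m) (hY n) ht z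
    have h2 := hN m hm n hn
    rw [dist_eq_norm] at h2
    have h3 : t * ‖Y m z - Y n z‖ ≤ ε / 3 := by
      calc t * ‖Y m z - Y n z‖ ≤ (t + 1) * (ε / (3 * (t + 1))) := by gcongr; linarith
        _ = ε / 3 := by field_simp
    have e : NormedSpace.exp (t • Y m) x - NormedSpace.exp (t • Y n) x =
        NormedSpace.exp (t • Y m) (x - z) +
          (NormedSpace.exp (t • Y m) z - NormedSpace.exp (t • Y n) z) -
          NormedSpace.exp (t • Y n) (x - z) := by
      rw [map_sub, map_sub]; abel
    rw [dist_eq_norm, e]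
    refine (norm_sub_le _ _).trans_lt ?_
    have h4 := norm_add_le (NormedSpace.exp (t • Y m) (x - z))
      (NormedSpace.exp (t • Y m) z - NormedSpace.exp (t • Y n) z)
    have h5 := hle m (x - z)
    have h6 := hle n (x - z)
    linarith
  choose f hf using hex
  refine ⟨continuousLinearMapOfTendsto _ (tendsto_pi_nhds.2 hf), ?_, hf⟩
  refine ContinuousLinearMap.opNorm_le_bound _ zero_le_one fun x => ?_
  rw [one_mul]
  exact le_of_tendsto (hf x).norm (Eventually.of_forall fun n => hle n x)

/-- A densely defined operator with contractive resolvents generates any contraction family that is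
the strong limit of the exponentials of its Yosida approximations. -/
theorem generates_of_tendsto_exp_yosida [CompleteSpace E] {A : E →ₗ.[ℝ] E}
    (hdense : Dense (A.domain : Set E))
    (hsurj : ∀ y, ∃ x, (x, x - y) ∈ A.graph) {Y : ℕ → E →L[ℝ] E}
    (hY : ∀ n, ∀ t : ℝ, 0 ≤ t → ‖NormedSpace.exp (t • Y n)‖ ≤ 1)
    (hlim : ∀ p ∈ A.graph, Tendsto (fun n => Y n p.1) atTop (𝓝 p.2))
    {T : ℝ≥0 → E →L[ℝ] E} (hT : ∀ t, ‖T t‖ ≤ 1)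
    (hTY : ∀ (t : ℝ≥0) x, Tendsto (fun n => NormedSpace.exp ((t : ℝ) • Y n) x) atTop (𝓝 (T t x))) :
    Generates A T := by
  have hTle : ∀ t x, ‖T t x‖ ≤ ‖x‖ := fun t x => by
    simpa using ContinuousLinearMap.le_of_opNorm_le _ (hT t) x
  have hdef : ∀ p ∈ A.graph, ∀ t : ℝ≥0, ‖T t p.1 - p.1‖ ≤ t * ‖p.2‖ := fun p hp t =>
    le_of_tendsto_of_tendsto' ((hTY t p.1).sub_const _).norm ((hlim p hp).norm.const_mul _)
      fun n => norm_exp_smul_sub_self_le (hY n) t.2 p.1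
  have htaylor : ∀ p ∈ A.graph, ∀ q ∈ A.graph, ∀ t : ℝ≥0,
      ‖T t p.1 - p.1 - (t : ℝ) • p.2‖ ≤ t * (2 * ‖p.2 - q.1‖ + t * ‖q.2‖) := by
    intro p hp q hq t
    exact le_of_tendsto_of_tendsto'
      (((hTY t p.1).sub_const _).sub ((hlim p hp).const_smul _)).norm
      ((((hlim p hp).sub_const _).norm.const_mul _ |>.add
        ((hlim q hq).norm.const_mul _)).const_mul _)
      fun n => norm_exp_smul_sub_self_sub_le (hY n) t.2 p.1 q.1
  have hsmall : ∀ (c δ : ℝ), 0 < δ → ∀ᶠ t : ℝ≥0 in 𝓝[>] 0, (t : ℝ) * c < δ := by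
    intro c δ hδ
    have : Tendsto (fun t : ℝ≥0 => (t : ℝ) * c) (𝓝[>] 0) (𝓝 (((0 : ℝ≥0) : ℝ) * c)) :=
      (NNReal.continuous_coe.mul continuous_const).continuousAt.tendsto.mono_left
        nhdsWithin_le_nhds
    exact this.eventually (gt_mem_nhds (by simpa using hδ))
  -- The generator of `T` extends `A`.
  have hext : ∀ p ∈ A.graph,
      Tendsto (fun t : ℝ≥0 => (t : ℝ)⁻¹ • (T t p.1 - p.1)) (𝓝[>] 0) (𝓝 p.2) := by
    intro p hp
    rw [Metric.tendsto_nhds]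
    intro ε hε
    obtain ⟨z, hz, hpz⟩ := Metric.dense_iff.1 hdense p.2 (ε / 4) (by positivity)
    rw [Metric.mem_ball, dist_eq_norm, norm_sub_rev] at hz
    obtain ⟨w, hw⟩ := LinearPMap.mem_domain_iff.1 hpz
    filter_upwards [hsmall ‖w‖ (ε / 2) (by positivity), self_mem_nhdsWithin] with t h1 ht
    have ht' : (0 : ℝ) < t := ht
    have h2 := htaylor p hp _ hw t
    have e : (t : ℝ)⁻¹ • (T t p.1 - p.1) - p.2 =
        (t : ℝ)⁻¹ • (T t p.1 - p.1 - (t : ℝ) • p.2) := by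
      rw [smul_sub (t : ℝ)⁻¹ (T t p.1 - p.1), inv_smul_smul₀ ht'.ne']
    rw [dist_eq_norm, e, norm_smul, norm_inv, Real.norm_of_nonneg ht'.le, inv_mul_eq_div,
      div_lt_iff₀ ht', mul_comm]
    refine h2.trans_lt (mul_lt_mul_of_pos_left ?_ ht')
    simp only
    linarith
  refine ⟨⟨?_, ?_, ?_⟩, fun x y => ⟨fun h => hext _ h, fun h => ?_⟩⟩
  · ext x
    have h := hTY 0 x
    simp only [NNReal.coe_zero, zero_smul, NormedSpace.exp_zero] at h
    exact tendsto_nhds_unique h tendsto_const_nhds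
  · intro s t
    ext x
    refine tendsto_nhds_unique (hTY (s + t) x) ?_
    have h1 := hTY s (T t x)
    have h2 : Tendsto (fun n => NormedSpace.exp ((s : ℝ) • Y n)
        (NormedSpace.exp ((t : ℝ) • Y n) x - T t x)) atTop (𝓝 0) := by
      have h3 := ((hTY t x).sub_const (T t x)).norm
      rw [sub_self, norm_zero] at h3
      refine squeeze_zero_norm (fun n => ?_) h3
      exact (ContinuousLinearMap.le_of_opNorm_le _ (hY n s s.2) _).trans_eq (one_mul _)
    have h4 := h2.add h1
    rw [zero_add] at h4
    refine h4.congr fun n => ?_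
    let _ : NormedAlgebra ℚ (E →L[ℝ] E) := NormedAlgebra.restrictScalars ℚ ℝ _
    rw [NNReal.coe_add, add_smul, NormedSpace.exp_add_of_commute
      (((Commute.refl (Y n)).smul_left _).smul_right _), map_sub, sub_add_cancel]
    rfl
  · intro x
    rw [Metric.tendsto_nhds]
    intro ε hε
    obtain ⟨z, hz, hxz⟩ := Metric.dense_iff.1 hdense x (ε / 3) (by positivity)
    rw [Metric.mem_ball, dist_eq_norm, norm_sub_rev] at hz
    obtain ⟨w, hw⟩ := LinearPMap.mem_domain_iff.1 hxz
    filter_upwards [hsmall ‖w‖ (ε / 3) (by positivity)] with t h1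
    have h2 := hdef _ hw t
    have e : T t x - x = T t (x - z) + (T t z - z) - (x - z) := by rw [map_sub]; abel
    rw [dist_eq_norm, e]
    have h3 := norm_sub_le (T t (x - z) + (T t z - z)) (x - z)
    have h4 := norm_add_le (T t (x - z)) (T t z - z)
    have h5 := hTle t (x - z)
    simp only at h2
    linarith
  · -- Since `1 - A` is onto and `1 - B` is injective for the generator `B` of `T`, the two agree.
    obtain ⟨x', hx'⟩ := hsurj (x - y)
    have h1 := h.sub (hext _ hx')
    simp only at h1
    have e1 : y - (x' - (x - y)) = x - x' := by abel
    rw [e1] at h1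
    have h2 : Tendsto (fun t : ℝ≥0 => (x - x') - (t : ℝ)⁻¹ • (T t (x - x') - (x - x')))
        (𝓝[>] 0) (𝓝 0) := by
      rw [← sub_self (x - x')]
      refine tendsto_const_nhds.sub (h1.congr fun t => ?_)
      rw [← smul_sub, map_sub]
      congr 1
      abel
    have h3 : ‖x - x'‖ ≤ 0 := by
      rw [← norm_zero (E := E)]
      refine ge_of_tendsto h2.norm ?_
      filter_upwards [self_mem_nhdsWithin] with t ht
      have ht' : (0 : ℝ) < t := ht
      have h4 : (x - x') - (t : ℝ)⁻¹ • (T t (x - x') - (x - x')) =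
          (1 + (t : ℝ)⁻¹) • (x - x') - (t : ℝ)⁻¹ • T t (x - x') := by
        rw [smul_sub, add_smul, one_smul]; abel
      rw [h4]
      refine le_trans ?_ (norm_sub_norm_le _ _)
      rw [norm_smul, norm_smul, Real.norm_of_nonneg (by positivity),
        Real.norm_of_nonneg (by positivity)]
      have := mul_le_mul_of_nonneg_left (hTle t (x - x')) (inv_nonneg.2 ht'.le)
      linarith
    have h4 : x = x' := sub_eq_zero.1 (norm_le_zero_iff.1 h3)
    subst h4
    simpa using hx'

/-- **Lumer–Phillips theorem**, with positivity: a densely defined dissipative operator `A` such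
that `μ - A` is onto for all `μ > 0` generates a contraction semigroup, which preserves every closed
convex cone preserved by the resolvents of `A`. -/
theorem exists_generates_of_dissipative [CompleteSpace E] {A : E →ₗ.[ℝ] E}
    (hdense : Dense (A.domain : Set E))
    (hdiss : ∀ μ : ℝ, 0 < μ → ∀ p ∈ A.graph, μ * ‖p.1‖ ≤ ‖μ • p.1 - p.2‖)
    (hsurj : ∀ μ : ℝ, 0 < μ → ∀ y, ∃ x, (x, μ • x - y) ∈ A.graph)
    {K : Set E} (hK : IsClosed K) (h0 : (0 : E) ∈ K)
    (hadd : ∀ x ∈ K, ∀ y ∈ K, x + y ∈ K) (hsmul : ∀ c : ℝ, 0 ≤ c → ∀ x ∈ K, c • x ∈ K)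
    (hpos : ∀ μ : ℝ, 0 < μ → ∀ p ∈ A.graph, μ • p.1 - p.2 ∈ K → p.1 ∈ K) :
    ∃ T : ℝ≥0 → E →L[ℝ] E, Generates A T ∧ (∀ t, ∀ x ∈ K, T t x ∈ K) ∧ ∀ t, ‖T t‖ ≤ 1 := by
  let μ : ℕ → ℝ := fun n => n + 1
  have hμ : ∀ n, 0 < μ n := fun n => by positivity
  have hμ' : Tendsto μ atTop atTop :=
    tendsto_atTop_add_const_right _ _ tendsto_natCast_atTop_atTop
  choose R hR hR' using fun n => exists_isResolvent (hμ n) (hdiss _ (hμ n)) (hsurj _ (hμ n))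
  have hY : ∀ n, ∀ t : ℝ, 0 ≤ t → ‖NormedSpace.exp (t • yosida (μ n) (R n))‖ ≤ 1 :=
    fun n t ht => norm_exp_smul_yosida_le (hμ n) (hR' n) ht
  have hlim : ∀ p ∈ A.graph, Tendsto (fun n => yosida (μ n) (R n) p.1) atTop (𝓝 p.2) := by
    intro p hp
    refine (tendsto_smul_resolvent hdense hμ hμ' hR hR' p.2).congr fun n => ?_
    exact (yosida_apply_of_mem_graph (hR n) hp).symm
  choose T hT hTY using fun t : ℝ≥0 => exists_tendsto_exp_yosida hdense hY
    (fun m n => commute_yosida ((hR m).commute (hR n))) hlim t t.2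
  refine ⟨T, generates_of_tendsto_exp_yosida hdense (fun y => ?_) hY hlim hT hTY, ?_, hT⟩
  · simpa using hsurj 1 one_pos y
  · intro t x hx
    refine hK.mem_of_tendsto (hTY t x) (Eventually.of_forall fun n => ?_)
    rw [exp_smul_yosida]
    refine hsmul _ (Real.exp_nonneg _) _
      (exp_apply_mem_of_mapsTo hK h0 hadd hsmul (fun z hz => ?_) hx)
    refine hsmul _ (mul_nonneg t.2 (sq_nonneg _)) _ (hpos _ (hμ n) _ ((hR n).mem_graph z) ?_)
    simpa using hz

end LumerPhillips

/-! ### Primitives and `W^{1,1}(0, L)` -/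

theorem integral_intervalMeasure {L : ℝ} (hL : 0 ≤ L) (f : ℝ → ℝ) :
    ∫ x, f x ∂(intervalMeasure L) = ∫ x in (0 : ℝ)..L, f x := by
  rw [intervalIntegral.integral_of_le hL, integral_Ioc_eq_integral_Ioo]

theorem integrable_intervalMeasure_iff {L : ℝ} (hL : 0 ≤ L) {f : ℝ → ℝ} :
    Integrable f (intervalMeasure L) ↔ IntervalIntegrable f volume 0 L :=
  (intervalIntegrable_iff_integrableOn_Ioo_of_le hL).symm

theorem integrable_of_continuousOn {L : ℝ} {f : ℝ → ℝ} (hf : ContinuousOn f (Icc 0 L)) :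
    Integrable f (intervalMeasure L) :=
  (hf.integrableOn_Icc).mono_set Ioo_subset_Icc_self

theorem eqOn_Icc_of_ae_eq {L : ℝ} (hL : 0 < L) {f g : ℝ → ℝ} (hf : ContinuousOn f (Icc 0 L))
    (hg : ContinuousOn g (Icc 0 L)) (h : f =ᵐ[intervalMeasure L] g) : EqOn f g (Icc 0 L) := by
  refine Measure.eqOn_Icc_of_ae_eq volume hL.ne ?_ hf hg
  rwa [← restrict_Ioo_eq_restrict_Icc]

/-- The primitive of `h` with value `c` at `0`. -/
noncomputable def primitive (c : ℝ) (h : ℝ → ℝ) (x : ℝ) : ℝ := c + ∫ t in (0 : ℝ)..x, h t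

@[simp]
theorem primitive_zero (c : ℝ) (h : ℝ → ℝ) : primitive c h 0 = c := by simp [primitive]

section Primitive

variable {L : ℝ} {h : ℝ → ℝ}

theorem absolutelyContinuousOnInterval_primitive (hL : 0 ≤ L)
    (hh : Integrable h (intervalMeasure L)) (c : ℝ) :
    AbsolutelyContinuousOnInterval (primitive c h) 0 L := by
  have h1 : AbsolutelyContinuousOnInterval (fun _ : ℝ => c) 0 L :=
    (contDiff_const.contDiffOn).absolutelyContinuousOnInterval
  exact h1.fun_add (((integrable_intervalMeasure_iff hL).1
    hh).absolutelyContinuousOnInterval_intervalIntegral left_mem_uIcc)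

theorem continuousOn_primitive (hL : 0 ≤ L) (hh : Integrable h (intervalMeasure L)) (c : ℝ) :
    ContinuousOn (primitive c h) (Icc 0 L) := by
  have := (absolutelyContinuousOnInterval_primitive hL hh c).continuousOn
  rwa [uIcc_of_le hL] at this

theorem ae_hasDerivAt_primitive (hL : 0 ≤ L) (hh : Integrable h (intervalMeasure L)) (c : ℝ) :
    ∀ᵐ x, x ∈ uIcc 0 L → HasDerivAt (primitive c h) (h x) x := by
  filter_upwards [((integrable_intervalMeasure_iff hL).1 hh).ae_hasDerivAt_integral] with x hx hx'
  exact (hx hx' 0 left_mem_uIcc).const_add c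

/-- Product rule, in integrated form, for a `C¹` function and an absolutely continuous one. -/
theorem mul_primitive_eq {W W' : ℝ → ℝ} (hW : ∀ x, HasDerivAt W (W' x) x) (hW' : Continuous W')
    (hL : 0 ≤ L) (hh : Integrable h (intervalMeasure L)) (c : ℝ) {x : ℝ} (hx : x ∈ Icc 0 L) :
    W x * primitive c h x = W 0 * c + ∫ t in (0 : ℝ)..x, (W' t * primitive c h t + W t * h t) := by
  have hd : deriv W = W' := funext fun x => (hW x).deriv
  have hWac : AbsolutelyContinuousOnInterval W 0 x :=
    (contDiff_one_iff_deriv.2 ⟨fun x => (hW x).differentiableAt,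
      hd ▸ hW'⟩).contDiffOn.absolutelyContinuousOnInterval
  have hsub : uIcc 0 x ⊆ uIcc 0 L := by
    rw [uIcc_of_le hx.1, uIcc_of_le hL]
    exact Icc_subset_Icc_right hx.2
  have hF := (absolutelyContinuousOnInterval_primitive hL hh c).mono hsub
  have h1 := hWac.integral_deriv_mul_eq_sub hF
  rw [primitive_zero] at h1
  rw [← sub_eq_iff_eq_add', ← h1]
  refine intervalIntegral.integral_congr_ae ?_
  filter_upwards [ae_hasDerivAt_primitive hL hh c] with t ht ht'
  rw [hd, (ht (hsub (uIoc_subset_uIcc ht'))).deriv]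

theorem hasWeakDeriv_primitive (hL : 0 ≤ L) (hh : Integrable h (intervalMeasure L)) (c : ℝ) :
    HasWeakDeriv L (primitive c h) h := by
  intro φ hφ
  have hz : ∀ x, x ∉ Ioo 0 L → φ x = 0 := fun x hx =>
    image_eq_zero_of_notMem_tsupport fun h' => hx (hφ.support_subset h')
  have h1 := mul_primitive_eq (W := φ) (W' := deriv φ)
    (fun x => (hφ.smooth.differentiable (by simp) x).hasDerivAt)
    (hφ.smooth.continuous_deriv (by simp)) hL hh c (right_mem_Icc.2 hL)
  rw [hz 0 (by simp), hz L (by simp), zero_mul, zero_mul, zero_add,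
    ← integral_intervalMeasure hL] at h1
  have hF := integrable_of_continuousOn (continuousOn_primitive hL hh c)
  rw [← sub_eq_zero, sub_neg_eq_add,
    ← integral_add (hφ.integrable_mul_deriv hF) (hφ.integrable_mul hh)]
  rw [h1]
  congr 1 with x
  ring

end Primitive

theorem IsTestFunction.sub_smul {L : ℝ} {φ ψ : ℝ → ℝ} (hφ : IsTestFunction L φ)
    (hψ : IsTestFunction L ψ) (c : ℝ) : IsTestFunction L (fun x => φ x - c * ψ x) := by
  have hs : Function.support (fun x => φ x - c * ψ x) ⊆ tsupport φ ∪ tsupport ψ := by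
    intro x hx
    by_contra hn
    rw [mem_union, not_or] at hn
    exact hx (by simp [image_eq_zero_of_notMem_tsupport hn.1,
      image_eq_zero_of_notMem_tsupport hn.2])
  have ht := closure_minimal hs ((isClosed_tsupport φ).union (isClosed_tsupport ψ))
  exact ⟨hφ.smooth.sub (contDiff_const.mul hψ.smooth),
    (IsCompact.union hφ.compact hψ.compact).of_isClosed_subset (isClosed_tsupport _) ht,
    ht.trans (union_subset hφ.support_subset hψ.support_subset)⟩

/-- A test function with vanishing integral is the derivative of a test function. -/
theorem IsTestFunction.exists_deriv_eq {L : ℝ} {θ : ℝ → ℝ} (hθ : IsTestFunction L θ)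
    (h0 : ∫ x in (0 : ℝ)..L, θ x = 0) : ∃ φ, IsTestFunction L φ ∧ deriv φ = θ := by
  have hc := hθ.smooth.continuous
  obtain ⟨a, b, ha, hb, hab⟩ : ∃ a b, 0 < a ∧ b < L ∧ tsupport θ ⊆ Icc a b := by
    rcases (tsupport θ).eq_empty_or_nonempty with he | hne
    · exact ⟨1, L - 1, one_pos, by linarith, by simp [he]⟩
    · have hcpt : IsCompact (tsupport θ) := hθ.compact
      exact ⟨_, _, (hθ.support_subset (hcpt.sInf_mem hne)).1,
        (hθ.support_subset (hcpt.sSup_mem hne)).2,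
        subset_Icc_csInf_csSup hcpt.bddBelow hcpt.bddAbove⟩
  have hz : ∀ x, x ∉ Icc a b → θ x = 0 := fun x hx =>
    image_eq_zero_of_notMem_tsupport fun h' => hx (hab h')
  have hzero : ∀ u v : ℝ, (∀ x ∈ uIoc u v, x ∉ Icc a b) → ∫ x in u..v, θ x = 0 := by
    intro u v huv
    rw [intervalIntegral.integral_congr_ae (g := fun _ => 0)
      (Eventually.of_forall fun x hx => hz x (huv x hx))]
    simp
  let φ : ℝ → ℝ := fun x => ∫ t in (0 : ℝ)..x, θ t
  have hd : ∀ x, HasDerivAt φ (θ x) x := fun x => hc.integral_hasStrictDerivAt 0 x |>.hasDerivAt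
  have hderiv : deriv φ = θ := funext fun x => (hd x).deriv
  have hsupp : Function.support φ ⊆ Icc a b := by
    intro x hx
    by_contra hn
    apply hx
    rcases lt_or_ge x a with hxa | hxa
    · refine hzero 0 x fun t ht ht' => ?_
      exact absurd (ht.2.trans_lt (max_lt ha hxa)) (not_lt.2 ht'.1)
    · have hxb : b < x := by
        by_contra hxb
        exact hn ⟨hxa, not_lt.1 hxb⟩
      have h1 : ∫ t in x..L, θ t = 0 := by
        refine hzero x L fun t ht ht' => ?_
        exact absurd ((lt_min hxb hb).trans ht.1) (not_lt.2 ht'.2)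
      have h2 := intervalIntegral.integral_add_adjacent_intervals
        (hc.intervalIntegrable (μ := volume) 0 x) (hc.intervalIntegrable x L)
      rwa [h1, h0, add_zero] at h2
  have ht : tsupport φ ⊆ Icc a b := closure_minimal hsupp isClosed_Icc
  refine ⟨φ, ⟨?_, isCompact_Icc.of_isClosed_subset (isClosed_tsupport _) ht,
    ht.trans fun x hx => ⟨ha.trans_le hx.1, hx.2.trans_lt hb⟩⟩, hderiv⟩
  exact contDiff_infty_iff_deriv.2 ⟨fun x => (hd x).differentiableAt, hderiv ▸ hθ.smooth⟩

/-- There is a test function on `(0, L)` with integral `1`. -/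
theorem exists_isTestFunction_integral_eq_one {L : ℝ} (hL : 0 < L) :
    ∃ η, IsTestFunction L η ∧ ∫ x in (0 : ℝ)..L, η x = 1 := by
  let f : ContDiffBump (L / 2) := ⟨L / 8, L / 4, by positivity, by linarith⟩
  have hs : tsupport (f.normed volume) ⊆ Ioo 0 L := by
    rw [f.tsupport_normed_eq, Real.closedBall_eq_Icc]
    intro x hx
    have h1 : L / 2 - L / 4 ≤ x := hx.1
    have h2 : x ≤ L / 2 + L / 4 := hx.2
    constructor <;> linarith
  refine ⟨f.normed volume, ⟨f.contDiff_normed, f.hasCompactSupport_normed, hs⟩, ?_⟩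
  rw [← integral_intervalMeasure hL.le, setIntegral_eq_integral_of_forall_compl_eq_zero,
    f.integral_normed]
  exact fun x hx => image_eq_zero_of_notMem_tsupport fun h' => hx (hs h')

/-- An integrable function with zero weak derivative is constant (du Bois-Reymond): every test
function differs from a derivative of a test function by a multiple of a fixed one. -/
theorem HasWeakDeriv.ae_eq_const {L : ℝ} (hL : 0 < L) {f : ℝ → ℝ}
    (hf : Integrable f (intervalMeasure L)) (H : HasWeakDeriv L f 0) :
    ∃ c, f =ᵐ[intervalMeasure L] fun _ => c := by
  obtain ⟨η, hη, hη1⟩ := exists_isTestFunction_integral_eq_one hL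
  set c := ∫ x, f x * η x ∂(intervalMeasure L) with hc
  have key : ∀ ψ, IsTestFunction L ψ →
      ∫ x, f x * ψ x ∂(intervalMeasure L) = c * ∫ x, ψ x ∂(intervalMeasure L) := by
    intro ψ hψ
    set I := ∫ x, ψ x ∂(intervalMeasure L) with hI
    obtain ⟨φ, hφ, hφ'⟩ := (hψ.sub_smul hη I).exists_deriv_eq (by
      rw [intervalIntegral.integral_sub (hψ.smooth.continuous.intervalIntegrable _ _)
        ((hη.smooth.continuous.intervalIntegrable _ _).const_mul I),
        intervalIntegral.integral_const_mul, hη1, ← integral_intervalMeasure hL.le, ← hI]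
      ring)
    have h1 := H φ hφ
    rw [hφ'] at h1
    have e : ∀ x, f x * (ψ x - I * η x) = f x * ψ x - I * (f x * η x) := fun x => by ring
    simp only [e, Pi.zero_apply, zero_mul, integral_zero, neg_zero] at h1
    rw [integral_sub (hψ.integrable_mul hf) ((hη.integrable_mul hf).const_mul I),
      integral_const_mul, sub_eq_zero] at h1
    rw [h1, mul_comm]
  refine ⟨c, ?_⟩
  have hfc : Integrable (fun x => f x - c) (intervalMeasure L) := hf.sub (integrable_const c)
  have h2 := HasWeakDeriv.unique (f := 0) hfc (integrable_zero _ _ _) (fun ψ hψ => ?_)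
    (k := fun _ => 0) (fun ψ hψ => by simp)
  · filter_upwards [h2] with x hx
    linarith
  · have hψi : Integrable ψ (intervalMeasure L) := by
      simpa using hψ.integrable_mul (integrable_const (1 : ℝ))
    simp only [Pi.zero_apply, zero_mul, integral_zero, sub_mul]
    rw [integral_sub (hψ.integrable_mul hf) (hψi.const_mul c), key ψ hψ, integral_const_mul]
    ring

/-- A function with integrable weak derivative `h` is a primitive of `h`. -/
theorem HasWeakDeriv.exists_ae_eq_primitive {L : ℝ} (hL : 0 < L) {f h : ℝ → ℝ}
    (hf : Integrable f (intervalMeasure L)) (hh : Integrable h (intervalMeasure L))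
    (H : HasWeakDeriv L f h) : ∃ c, f =ᵐ[intervalMeasure L] primitive c h := by
  have hP := integrable_of_continuousOn (continuousOn_primitive hL.le hh 0)
  have h1 := H.add hf (hP.smul (-1 : ℝ)) hh (hh.smul (-1 : ℝ))
    ((hasWeakDeriv_primitive hL.le hh 0).smul (-1))
  simp only [neg_one_smul, add_neg_cancel] at h1
  obtain ⟨c, hc⟩ := h1.ae_eq_const hL (hf.add hP.neg)
  refine ⟨c, ?_⟩
  filter_upwards [hc] with x hx
  simp only [Pi.add_apply, Pi.neg_apply, primitive] at hx ⊢
  linarith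

theorem memW11_of_ae_eq_primitive {L : ℝ} (hL : 0 ≤ L) {f h : ℝ → ℝ} {c : ℝ}
    (hh : Integrable h (intervalMeasure L)) (hf : f =ᵐ[intervalMeasure L] primitive c h) :
    MemW11 L f ∧ weakDeriv L f =ᵐ[intervalMeasure L] h := by
  have h1 := integrable_of_continuousOn (continuousOn_primitive hL hh c)
  have h2 := hasWeakDeriv_primitive hL hh c
  exact ⟨MemW11.congr hf.symm ⟨h1, h, hh, h2⟩,
    (h2.congr hf.symm).weakDeriv_ae_eq (h1.congr hf.symm) hh⟩

/-! ### The state space -/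

section StateSpace

variable {L : ℝ}

/-- The total mass `p₀ + ∫ p₁` of a state. -/
noncomputable def totalMass (P : StateSpace L) : ℝ := P.fst + ∫ x, P.snd x ∂(intervalMeasure L)

theorem norm_eq_add_integral (P : StateSpace L) :
    ‖P‖ = |P.fst| + ∫ x, |P.snd x| ∂(intervalMeasure L) := by
  rw [WithLp.prod_norm_eq_add (by simp), L1.norm_eq_integral_norm]
  simp

theorem integrable_snd (P : StateSpace L) : Integrable P.snd (intervalMeasure L) :=
  L1.integrable_coeFn P.snd

theorem stateNonneg_iff {P : StateSpace L} :
    StateNonneg P ↔ 0 ≤ P.fst ∧ ∀ᵐ x ∂(intervalMeasure L), 0 ≤ P.snd x := by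
  rw [StateNonneg, ← Lp.coeFn_nonneg]
  rfl

theorem norm_eq_totalMass_of_nonneg {P : StateSpace L} (hP : StateNonneg P) : ‖P‖ = totalMass P := by
  rw [stateNonneg_iff] at hP
  rw [norm_eq_add_integral, totalMass, abs_of_nonneg hP.1]
  congr 1
  refine integral_congr_ae ?_
  filter_upwards [hP.2] with x hx using abs_of_nonneg hx

theorem snd_smul_sub_ae_eq (μ : ℝ) (P Q : StateSpace L) :
    (μ • P - Q).snd =ᵐ[intervalMeasure L] fun x => μ * P.snd x - Q.snd x := by
  filter_upwards [Lp.coeFn_sub (μ • P.snd) Q.snd, Lp.coeFn_smul μ P.snd] with x h1 h2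
  change (μ • P.snd - Q.snd : Lp ℝ 1 (intervalMeasure L)) x = _
  rw [h1, Pi.sub_apply, h2]
  rfl

theorem totalMass_smul_sub (μ : ℝ) (P Q : StateSpace L) :
    totalMass (μ • P - Q) = μ * totalMass P - totalMass Q := by
  rw [totalMass, integral_congr_ae (snd_smul_sub_ae_eq μ P Q),
    integral_sub ((integrable_snd P).const_mul μ) (integrable_snd Q),
    integral_const_mul, totalMass, totalMass, WithLp.sub_fst, WithLp.smul_fst, smul_eq_mul]
  ring

theorem isClosed_stateNonneg : IsClosed {P : StateSpace L | StateNonneg P} := by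
  have h1 : Continuous fun P : StateSpace L => P.fst := by fun_prop
  have h2 : Continuous fun P : StateSpace L => P.snd := by fun_prop
  have hs : {P : StateSpace L | StateNonneg P} =
      (fun P => P.fst) ⁻¹' Ici 0 ∩ (fun P => P.snd) ⁻¹' Ici 0 := rfl
  rw [hs]
  exact (isClosed_Ici.preimage h1).inter (isClosed_Ici.preimage h2)

theorem StateNonneg.add {P Q : StateSpace L} (hP : StateNonneg P) (hQ : StateNonneg Q) :
    StateNonneg (P + Q) :=
  ⟨add_nonneg hP.1 hQ.1, add_nonneg hP.2 hQ.2⟩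

theorem StateNonneg.smul {P : StateSpace L} (hP : StateNonneg P) {c : ℝ} (hc : 0 ≤ c) :
    StateNonneg (c • P) := by
  rw [stateNonneg_iff] at hP ⊢
  refine ⟨mul_nonneg hc hP.1, ?_⟩
  filter_upwards [hP.2, Lp.coeFn_smul c P.snd] with x h1 h2
  rw [WithLp.smul_snd, h2]
  exact mul_nonneg hc h1

theorem stateNonneg_zero : StateNonneg (0 : StateSpace L) := ⟨le_rfl, le_rfl⟩

/-- The componentwise absolute value of a state. -/
noncomputable def stateAbs (P : StateSpace L) : StateSpace L := WithLp.toLp 1 (|P.fst|, |P.snd|)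

theorem stateNonneg_stateAbs (P : StateSpace L) : StateNonneg (stateAbs P) :=
  ⟨abs_nonneg P.fst, abs_nonneg P.snd⟩

theorem norm_stateAbs (P : StateSpace L) : ‖stateAbs P‖ = ‖P‖ := by
  rw [WithLp.prod_norm_eq_add (by simp), WithLp.prod_norm_eq_add (by simp)]
  simp [stateAbs, norm_abs_eq_norm]

theorem norm_le_norm_of_nonneg {P Q : StateSpace L} (h1 : StateNonneg (Q - P))
    (h2 : StateNonneg (Q + P)) : ‖P‖ ≤ ‖Q‖ := by
  have a1 : |P.fst| ≤ |Q.fst| := by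
    refine (abs_le.2 ⟨?_, ?_⟩ : |P.fst| ≤ Q.fst).trans (le_abs_self _)
    · have := h2.1; rw [WithLp.add_fst] at this; linarith
    · have := h1.1; rw [WithLp.sub_fst] at this; linarith
  have a2 : |P.snd| ≤ |Q.snd| := by
    refine (abs_le'.2 ⟨?_, ?_⟩ : |P.snd| ≤ Q.snd).trans (le_abs_self _)
    · have := h1.2; rw [WithLp.sub_snd] at this; exact sub_nonneg.1 this
    · have := h2.2; rw [WithLp.add_snd] at this; exact neg_le_iff_add_nonneg.2 this
  rw [WithLp.prod_norm_eq_add (by simp), WithLp.prod_norm_eq_add (by simp)]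
  simp only [ENNReal.toReal_one, Real.rpow_one, one_div, inv_one]
  exact add_le_add a1 (norm_le_norm_of_abs_le_abs a2)

/-- A linear relation on the state space with zero total mass flux and positive, everywhere defined
resolvents is dissipative: the solution for the data `|F|` dominates the one for `F`. -/
theorem dissipative_of_positive {G : Submodule ℝ (StateSpace L × StateSpace L)}
    (hmass : ∀ p ∈ G, totalMass p.2 = 0) {μ : ℝ} (hμ : 0 < μ)
    (hsurj : ∀ F, ∃ P, (P, μ • P - F) ∈ G)
    (hpos : ∀ p ∈ G, StateNonneg (μ • p.1 - p.2) → StateNonneg p.1) :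
    ∀ p ∈ G, μ * ‖p.1‖ ≤ ‖μ • p.1 - p.2‖ := by
  rintro ⟨P, Q⟩ h
  set F := μ • P - Q with hF
  obtain ⟨P', h'⟩ := hsurj (stateAbs F)
  have hP' : StateNonneg P' := hpos _ h' (by
    rw [sub_sub_cancel]; exact stateNonneg_stateAbs F)
  have d1 : StateNonneg (P' - P) := hpos _ (G.sub_mem h' h) (by
    have e : μ • (P' - P) - (μ • P' - stateAbs F - Q) = stateAbs F - F := by
      rw [hF, smul_sub]; abel
    rw [Prod.mk_sub_mk, e]
    exact ⟨sub_nonneg.2 (le_abs_self F.fst), sub_nonneg.2 (le_abs_self F.snd)⟩)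
  have d2 : StateNonneg (P' + P) := hpos _ (G.add_mem h' h) (by
    have e : μ • (P' + P) - (μ • P' - stateAbs F + Q) = stateAbs F + F := by
      rw [hF, smul_add]; abel
    rw [Prod.mk_add_mk, e]
    exact ⟨neg_le_iff_add_nonneg.1 (neg_le_abs F.fst), neg_le_iff_add_nonneg.1 (neg_le_abs F.snd)⟩)
  have m := hmass _ h'
  rw [totalMass_smul_sub, sub_eq_zero] at m
  calc μ * ‖P‖ ≤ μ * ‖P'‖ := by gcongr; exact norm_le_norm_of_nonneg d1 d2
    _ = ‖F‖ := by
      rw [norm_eq_totalMass_of_nonneg hP', m,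
        ← norm_eq_totalMass_of_nonneg (stateNonneg_stateAbs F), norm_stateAbs]

end StateSpace

/-! ### Domain, positivity and range of the closed-loop operator -/

namespace IsDesiredState

variable {lam L p₀s : ℝ} {p₁s : ℝ → ℝ}

theorem left_pos (hP : IsDesiredState lam L p₀s p₁s) (hlam : 0 < lam) (hL : 0 < L) : 0 < p₀s := by
  have hi := integrable_weakDeriv L p₁s
  obtain ⟨c, hc⟩ := hP.memW11.hasWeakDeriv.exists_ae_eq_primitive hL hP.memW11.1 hi
  have heq := eqOn_Icc_of_ae_eq hL hP.continuousOn (continuousOn_primitive hL.le hi c) hc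
  have h0 := heq (left_mem_Icc.2 hL.le)
  have hmid := heq (show L / 2 ∈ Icc 0 L by constructor <;> linarith)
  have hpos := hP.pos (L / 2) (by constructor <;> linarith)
  have hle : ∫ t in (0 : ℝ)..L / 2, weakDeriv L p₁s t ≤ 0 := by
    rw [intervalIntegral.integral_of_le (by positivity), integral_Ioc_eq_integral_Ioo]
    refine integral_nonpos_of_ae ?_
    have hs : Ioo 0 (L / 2) ⊆ Ioo 0 L := Ioo_subset_Ioo_right (by linarith)
    filter_upwards [ae_restrict_of_ae_restrict_of_subset hs hP.deriv_neg] with x hx using hx.le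
  rw [primitive_zero, hP.left_value] at h0
  rw [hmid, primitive] at hpos
  have : 0 < lam * p₀s := by linarith
  exact pos_of_mul_pos_right this hlam.le

theorem nonneg_on_Icc (hP : IsDesiredState lam L p₀s p₁s) (hlam : 0 < lam) {x : ℝ}
    (hx : x ∈ Icc 0 L) : 0 ≤ p₁s x := by
  rcases hx.1.eq_or_lt with rfl | h0
  · rw [hP.left_value]; exact mul_nonneg hlam.le hP.nonneg
  · rcases hx.2.eq_or_lt with rfl | h1
    · rw [hP.right_value]
    · exact (hP.pos x ⟨h0, h1⟩).le

/-- An element of the graph of the closed-loop operator is given by the absolutely continuous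
function `u = p₁ / p₁*`, through its value `c` at `0` and its derivative `h`. -/
theorem mem_graph_iff (hP : IsDesiredState lam L p₀s p₁s) (hlam : 0 < lam) (hL : 0 < L)
    {P Q : StateSpace L} : (P, Q) ∈ (closedLoopOperator lam L p₁s).graph ↔
      ∃ (c : ℝ) (h : ℝ → ℝ), Integrable h (intervalMeasure L) ∧ P.fst = p₀s * c ∧
        P.snd =ᵐ[intervalMeasure L] (fun x => p₁s x * primitive c h x) ∧
        Q.fst = ∫ x, h x ∂(intervalMeasure L) ∧ Q.snd =ᵐ[intervalMeasure L] fun x => -h x := by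
  rw [LinearPMap.mem_graph_iff]
  constructor
  · rintro ⟨⟨P', hW, v, hv, ev, v0⟩, rfl, rfl⟩
    have hi := integrable_weakDeriv L (weighted p₁s P')
    obtain ⟨c, hc⟩ := hW.hasWeakDeriv.exists_ae_eq_primitive hL hW.1 hi
    have hsnd : P'.snd =ᵐ[intervalMeasure L]
        fun x => p₁s x * primitive c (weakDeriv L (weighted p₁s P')) x := by
      filter_upwards [hc, ae_restrict_mem measurableSet_Ioo] with x hx hx'
      rw [← hx, weighted, one_div, mul_inv_cancel_left₀ (hP.pos x hx').ne']
    refine ⟨c, _, hi, ?_, hsnd, rfl, ?_⟩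
    · have h0 := eqOn_Icc_of_ae_eq hL hv
        (hP.continuousOn.mul (continuousOn_primitive hL.le hi c)) (ev.symm.trans hsnd)
        (left_mem_Icc.2 hL.le)
      simp only [Pi.mul_apply, primitive_zero, v0, hP.left_value, mul_assoc] at h0
      exact mul_left_cancel₀ hlam.ne' h0
    · refine (Lp.coeFn_neg _).trans ?_
      filter_upwards [hi.coeFn_toL1] with x hx
      rw [Pi.neg_apply, hx]
  · rintro ⟨c, h, hh, hP0, hP1, hQ0, hQ1⟩
    have hw : weighted p₁s P =ᵐ[intervalMeasure L] primitive c h := by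
      filter_upwards [hP1, ae_restrict_mem measurableSet_Ioo] with x hx hx'
      rw [weighted, hx, one_div, inv_mul_cancel_left₀ (hP.pos x hx').ne']
    obtain ⟨hW, hd⟩ := memW11_of_ae_eq_primitive hL.le hh hw
    have hmem : P ∈ closedLoopDomain lam L p₁s := by
      refine ⟨hW, _, hP.continuousOn.mul (continuousOn_primitive hL.le hh c), hP1, ?_⟩
      simp only [Pi.mul_apply, primitive_zero, hP.left_value, hP0, mul_assoc]
    refine ⟨⟨P, hmem⟩, rfl, ?_⟩
    have hi := integrable_weakDeriv L (weighted p₁s P)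
    have e0 : ∫ x, weakDeriv L (weighted p₁s P) x ∂(intervalMeasure L) = Q.fst := by
      rw [hQ0, integral_congr_ae hd]
    have e1 : -hi.toL1 = Q.snd := by
      refine Lp.ext ((Lp.coeFn_neg _).trans ?_)
      filter_upwards [hi.coeFn_toL1, hd, hQ1] with x h1 h2 h3
      rw [Pi.neg_apply, h1, h2, h3]
    exact congrArg (WithLp.toLp 1) (Prod.ext e0 e1)

theorem totalMass_eq_zero_of_mem_graph (hP : IsDesiredState lam L p₀s p₁s) (hlam : 0 < lam)
    (hL : 0 < L) {P Q : StateSpace L} (h : (P, Q) ∈ (closedLoopOperator lam L p₁s).graph) :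
    totalMass Q = 0 := by
  obtain ⟨c, h, -, -, -, hQ0, hQ1⟩ := (hP.mem_graph_iff hlam hL).1 h
  rw [totalMass, integral_congr_ae hQ1, integral_neg, hQ0, add_neg_cancel]

/-- The integrating factor `W x = exp (μ ∫₀ˣ q)` of the resolvent equation. Here `q` is a continuous
extension of `p₁*` to the line, which makes `W` differentiable everywhere. -/
theorem exists_integratingFactor (hP : IsDesiredState lam L p₀s p₁s) (hlam : 0 < lam) (hL : 0 < L)
    (μ : ℝ) : ∃ q W : ℝ → ℝ, Continuous q ∧ EqOn q p₁s (Icc 0 L) ∧ (∀ x, 0 < W x) ∧ W 0 = 1 ∧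
      (∀ x, HasDerivAt W (μ * q x * W x) x) ∧ (0 < μ → 1 ≤ W L) := by
  let q : ℝ → ℝ := fun x => p₁s (max 0 (min L x))
  have hmem : ∀ x, max 0 (min L x) ∈ Icc 0 L := fun x =>
    ⟨le_max_left _ _, max_le hL.le (min_le_left _ _)⟩
  have hq : Continuous q := hP.continuousOn.comp_continuous (by fun_prop) hmem
  have hd : ∀ x, HasDerivAt (fun x => ∫ t in (0 : ℝ)..x, q t) (q x) x := fun x =>
    (hq.integral_hasStrictDerivAt 0 x).hasDerivAt
  refine ⟨q, fun x => Real.exp (μ * ∫ t in (0 : ℝ)..x, q t), hq, fun x hx => ?_,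
    fun x => Real.exp_pos _, by simp, fun x => ?_, fun hμ => ?_⟩
  · simp only [q, min_eq_right hx.2, max_eq_right hx.1]
  · have := ((hd x).const_mul μ).exp
    rwa [mul_comm] at this
  · refine Real.one_le_exp (mul_nonneg hμ.le ?_)
    exact intervalIntegral.integral_nonneg hL.le fun x _ => hP.nonneg_on_Icc hlam (hmem x)

/-- The resolvents are positive: for nonnegative data, `u` times the integrating factor is
nondecreasing, and the boundary condition forces `u(0) ≥ 0`. -/
theorem stateNonneg_of_resolvent (hP : IsDesiredState lam L p₀s p₁s) (hlam : 0 < lam) (hL : 0 < L)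
    {μ : ℝ} (hμ : 0 < μ) {P Q : StateSpace L}
    (h : (P, Q) ∈ (closedLoopOperator lam L p₁s).graph) (hF : StateNonneg (μ • P - Q)) :
    StateNonneg P := by
  obtain ⟨c, h, hh, hP0, hP1, hQ0, hQ1⟩ := (hP.mem_graph_iff hlam hL).1 h
  obtain ⟨q, W, hq, hqp, hW, hW0, hWd, hWL⟩ := hP.exists_integratingFactor hlam hL μ
  have hWc : Continuous W := continuous_iff_continuousAt.2 fun x => (hWd x).continuousAt
  rw [stateNonneg_iff] at hF ⊢
  obtain ⟨hF0, hF1⟩ := hF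
  have hsum : ∀ᵐ x ∂(intervalMeasure L), 0 ≤ μ * q x * W x * primitive c h x + W x * h x := by
    filter_upwards [hF1, snd_smul_sub_ae_eq μ P Q, hP1, hQ1, ae_restrict_mem measurableSet_Ioo]
      with x h1 h2 h3 h4 hx
    rw [h2, h3, h4, ← hqp (Ioo_subset_Icc_self hx)] at h1
    calc (0 : ℝ) ≤ W x * (μ * (q x * primitive c h x) - -h x) := mul_nonneg (hW x).le h1
      _ = _ := by ring
  have hge : ∀ x ∈ Icc 0 L, c ≤ W x * primitive c h x := by
    intro x hx
    have h1 := mul_primitive_eq hWd (by fun_prop) hL.le hh c hx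
    rw [h1, hW0, one_mul, le_add_iff_nonneg_right, intervalIntegral.integral_of_le hx.1,
      integral_Ioc_eq_integral_Ioo]
    exact integral_nonneg_of_ae
      (ae_restrict_of_ae_restrict_of_subset (Ioo_subset_Ioo_right hx.2) hsum)
  have hp₀ := hP.left_pos hlam hL
  have hc : 0 ≤ c := by
    by_contra hc
    rw [not_le] at hc
    have h1 := hge L (right_mem_Icc.2 hL.le)
    have h2 : c ≤ primitive c h L := by
      by_contra h2
      rw [not_le] at h2
      have h3 : W L * primitive c h L ≤ 1 * primitive c h L :=
        mul_le_mul_of_nonpos_right (hWL hμ) (h2.trans hc).le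
      linarith
    rw [WithLp.sub_fst, WithLp.smul_fst, hP0, hQ0, smul_eq_mul,
      integral_intervalMeasure hL.le] at hF0
    rw [primitive] at h2
    have h4 : μ * (p₀s * c) < 0 := mul_neg_of_pos_of_neg hμ (mul_neg_of_pos_of_neg hp₀ hc)
    linarith
  refine ⟨hP0 ▸ mul_nonneg hp₀.le hc, ?_⟩
  filter_upwards [hP1, ae_restrict_mem measurableSet_Ioo] with x h1 hx
  rw [h1]
  exact mul_nonneg (hP.pos x hx).le
    (nonneg_of_mul_nonneg_right (hc.trans (hge x (Ioo_subset_Icc_self hx))) (hW x))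

/-- The state with `p₁ = p₁* u` for a continuous function `u` with `u 0 = c`, `p₀ = p₀* c`. -/
theorem exists_state_of_continuousOn (hP : IsDesiredState lam L p₀s p₁s) (c : ℝ) {u : ℝ → ℝ}
    (hu : ContinuousOn u (Icc 0 L)) : ∃ P : StateSpace L, P.fst = p₀s * c ∧
      P.snd =ᵐ[intervalMeasure L] fun x => p₁s x * u x := by
  have hi := integrable_of_continuousOn (hP.continuousOn.mul hu)
  exact ⟨WithLp.toLp 1 (p₀s * c, hi.toL1), rfl, hi.coeFn_toL1⟩

/-- Solving the resolvent equation by the integrating factor. -/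
theorem exists_resolvent_solution (hP : IsDesiredState lam L p₀s p₁s) (hlam : 0 < lam) (hL : 0 < L)
    {μ : ℝ} (hμ : 0 < μ) (F : StateSpace L) :
    ∃ P, (P, μ • P - F) ∈ (closedLoopOperator lam L p₁s).graph := by
  obtain ⟨q, W, hq, hqp, hW, hW0, hWd, hWL⟩ := hP.exists_integratingFactor hlam hL μ
  have hWc : Continuous W := continuous_iff_continuousAt.2 fun x => (hWd x).continuousAt
  have hp₀ := hP.left_pos hlam hL
  have hVc : Continuous fun x => (W x)⁻¹ := hWc.inv₀ fun x => (hW x).ne'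
  have hVd : ∀ x, HasDerivAt (fun x => (W x)⁻¹) (-(μ * q x * (W x)⁻¹)) x := fun x => by
    convert! (hWd x).inv (hW x).ne' using 1
    have := (hW x).ne'
    field_simp
  have hk : Integrable (fun x => W x * F.snd x) (intervalMeasure L) := by
    have hF := (integrable_intervalMeasure_iff hL.le).1 (integrable_snd F)
    exact (integrable_intervalMeasure_iff hL.le).2 (hF.continuousOn_mul hWc.continuousOn)
  set κ := ∫ t in (0 : ℝ)..L, W t * F.snd t with hκ
  have hVL : (W L)⁻¹ ≤ 1 := inv_le_one_of_one_le₀ (hWL hμ)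
  have hden : 0 < μ * p₀s + 1 - (W L)⁻¹ := by
    have := mul_pos hμ hp₀
    linarith
  -- The value `c = u(0)` for which the equation of the first component holds.
  set c := (F.fst + (W L)⁻¹ * κ) / (μ * p₀s + 1 - (W L)⁻¹) with hc
  have hceq : c * (μ * p₀s + 1 - (W L)⁻¹) = F.fst + (W L)⁻¹ * κ := div_mul_cancel₀ _ hden.ne'
  set u : ℝ → ℝ := fun x => (W x)⁻¹ * primitive c (fun x => W x * F.snd x) x with hu
  have huc : ContinuousOn u (Icc 0 L) :=
    hVc.continuousOn.mul (continuousOn_primitive hL.le hk c)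
  set h : ℝ → ℝ := fun x => F.snd x - μ * (q x * u x) with hh
  have hhi : Integrable h (intervalMeasure L) :=
    (integrable_snd F).sub
      (integrable_of_continuousOn (continuousOn_const.mul (hq.continuousOn.mul huc)))
  have hup : ∀ x ∈ Icc 0 L, primitive c h x = u x := by
    intro x hx
    have h1 := mul_primitive_eq hVd (by fun_prop) hL.le hk c hx
    rw [hu]
    simp only
    rw [h1, hW0, inv_one, one_mul, primitive]
    congr 1
    refine intervalIntegral.integral_congr fun t _ => ?_
    simp only [hh, hu]
    have := (hW t).ne'
    field_simp
    ring
  obtain ⟨P, hP0, hP1⟩ := hP.exists_state_of_continuousOn c huc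
  refine ⟨P, (hP.mem_graph_iff hlam hL).2 ⟨c, h, hhi, hP0, ?_, ?_, ?_⟩⟩
  · filter_upwards [hP1, ae_restrict_mem measurableSet_Ioo] with x h1 hx
    rw [h1, hup x (Ioo_subset_Icc_self hx)]
  · have h1 := hup L (right_mem_Icc.2 hL.le)
    simp only [hu, primitive] at h1
    rw [integral_intervalMeasure hL.le, WithLp.sub_fst, WithLp.smul_fst, hP0, smul_eq_mul]
    have h2 : (W L)⁻¹ * (c + κ) = (W L)⁻¹ * c + (W L)⁻¹ * κ := mul_add _ _ _
    rw [← hκ, h2] at h1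
    linarith
  · filter_upwards [snd_smul_sub_ae_eq μ P F, hP1, ae_restrict_mem measurableSet_Ioo]
      with x h1 h2 hx
    rw [h1, h2, ← hqp (Ioo_subset_Icc_self hx)]
    simp only [hh]
    ring

/-- The domain is dense: `X` is the space `L¹(ν)` for `ν = p₀* δ₀ + p₁* dx`, by
`(p₀, p₁) ↦ (p₀ / p₀*, p₁ / p₁*)`, in which polynomials are dense. -/
theorem dense_domain (hP : IsDesiredState lam L p₀s p₁s) (hlam : 0 < lam) (hL : 0 < L) :
    Dense ((closedLoopOperator lam L p₁s).domain : Set (StateSpace L)) := by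
  have hp₀ := hP.left_pos hlam hL
  have hpi : Integrable p₁s (intervalMeasure L) := hP.memW11.1
  have hpm : AEMeasurable (fun x => (p₁s x).toNNReal) (intervalMeasure L) :=
    hpi.1.aemeasurable.real_toNNReal
  let ν₁ : Measure ℝ := (intervalMeasure L).withDensity fun x => (p₁s x).toNNReal
  have hfin : IsFiniteMeasure ν₁ := isFiniteMeasure_withDensity_ofReal hpi.2
  let ν : Measure ℝ := p₀s.toNNReal • Measure.dirac 0 + ν₁
  have hsmul : ∀ k : ℝ → ℝ, (fun x => (p₁s x).toNNReal • k x) =ᵐ[intervalMeasure L]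
      fun x => p₁s x * k x := by
    intro k
    filter_upwards [ae_restrict_mem measurableSet_Ioo] with x hx
    rw [NNReal.smul_def, Real.coe_toNNReal _ (hP.pos x hx).le, smul_eq_mul]
  have hint₁ : ∀ k : ℝ → ℝ, Integrable k ν₁ ↔
      Integrable (fun x => p₁s x * k x) (intervalMeasure L) := fun k =>
    (integrable_withDensity_iff_integrable_smul₀ hpm).trans (integrable_congr (hsmul k))
  have hint₀ : ∀ k : ℝ → ℝ, Integrable k (p₀s.toNNReal • Measure.dirac (0 : ℝ)) := fun k =>
    (integrable_dirac (by simp)).smul_measure_nnreal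
  have hval : ∀ k : ℝ → ℝ, Integrable k ν₁ → ∫ x, k x ∂ν =
      p₀s * k 0 + ∫ x, p₁s x * k x ∂(intervalMeasure L) := by
    intro k hk
    rw [integral_add_measure (hint₀ k) hk, integral_smul_nnreal_measure, integral_dirac,
      integral_withDensity_eq_integral_smul₀ hpm, integral_congr_ae (hsmul k), NNReal.smul_def,
      Real.coe_toNNReal _ hp₀.le, smul_eq_mul]
  rw [Metric.dense_iff]
  intro F ε hε
  let f : ℝ → ℝ := fun x => if x = 0 then F.fst / p₀s else F.snd x / p₁s x
  have hf0 : p₀s * f 0 = F.fst := by simp only [f, if_true]; field_simp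
  have hf1 : ∀ᵐ x ∂(intervalMeasure L), p₁s x * f x = F.snd x := by
    filter_upwards [ae_restrict_mem measurableSet_Ioo] with x hx
    simp only [f, if_neg hx.1.ne']
    have := (hP.pos x hx).ne'
    field_simp
  have hfi : Integrable f ν₁ := (hint₁ f).2 ((integrable_snd F).congr
    (hf1.mono fun x hx => hx.symm))
  obtain ⟨g, -, hfg, hgc, hgi⟩ := Integrable.exists_hasCompactSupport_integral_sub_le
    (μ := ν) ((hint₀ f).add_measure hfi) (show 0 < ε / 4 by positivity)
  have hd : Integrable (fun x => ‖f x - g x‖) ν₁ := (hfi.sub (hgi.mono_measure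
    (Measure.le_add_left le_rfl))).norm
  rw [hval _ hd] at hfg
  obtain ⟨π, hπ⟩ := exists_polynomial_near_of_continuousOn 0 L g hgc.continuousOn (ε / 4)
    (by positivity)
  have hπ' : ∀ x ∈ Icc 0 L, ‖f x - π.eval x‖ ≤ ‖f x - g x‖ + ε / 4 := by
    intro x hx
    have h1 := (hπ x hx).le
    rw [← Real.norm_eq_abs, norm_sub_rev] at h1
    have h2 := norm_sub_le_norm_sub_add_norm_sub (f x) (g x) (π.eval x)
    linarith
  have hπc : Continuous fun x => π.eval x := π.continuous
  obtain ⟨P, hP0, hP1⟩ := hP.exists_state_of_continuousOn (π.eval 0) hπc.continuousOn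
  have hmem : P ∈ (closedLoopOperator lam L p₁s).domain := by
    have hi : Integrable (fun x => π.derivative.eval x) (intervalMeasure L) :=
      integrable_of_continuousOn π.derivative.continuous.continuousOn
    have hprim : ∀ x, primitive (π.eval 0) (fun x => π.derivative.eval x) x = π.eval x := by
      intro x
      rw [primitive, intervalIntegral.integral_eq_sub_of_hasDerivAt
        (fun t _ => π.hasDerivAt t) (π.derivative.continuous.intervalIntegrable _ _)]
      ring
    refine LinearPMap.mem_domain_iff.2 ⟨WithLp.toLp 1 (_, -hi.toL1),
      (hP.mem_graph_iff hlam hL).2 ⟨_, _, hi, hP0, ?_, rfl, ?_⟩⟩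
    · simpa only [hprim] using hP1
    · refine (Lp.coeFn_neg _).trans ?_
      filter_upwards [hi.coeFn_toL1] with x hx
      rw [Pi.neg_apply, hx]
  refine ⟨P, ?_, hmem⟩
  have hd' := (hint₁ _).1 hd
  have hle : ∫ x, |(F - P).snd x| ∂(intervalMeasure L) ≤
      ∫ x, (p₁s x * ‖f x - g x‖ + p₁s x * (ε / 4)) ∂(intervalMeasure L) := by
    refine integral_mono_ae (integrable_snd _).abs (hd'.add (hpi.mul_const _)) ?_
    filter_upwards [Lp.coeFn_sub F.snd P.snd, hf1, hP1, ae_restrict_mem measurableSet_Ioo]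
      with x h1 h2 h3 hx
    rw [WithLp.sub_snd, h1, Pi.sub_apply, ← h2, h3, ← mul_sub, abs_mul,
      abs_of_pos (hP.pos x hx), ← mul_add]
    exact mul_le_mul_of_nonneg_left (hπ' x (Ioo_subset_Icc_self hx)) (hP.pos x hx).le
  rw [integral_add hd' (hpi.mul_const _), integral_mul_const] at hle
  have hle0 : |(F - P).fst| ≤ p₀s * (‖f 0 - g 0‖ + ε / 4) := by
    rw [WithLp.sub_fst, hP0, ← hf0, ← mul_sub, abs_mul, abs_of_pos hp₀]
    exact mul_le_mul_of_nonneg_left (hπ' 0 (left_mem_Icc.2 hL.le)) hp₀.le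
  rw [Metric.mem_ball, dist_eq_norm, norm_sub_rev, norm_eq_add_integral]
  -- The measure `ν` has total mass `1`.
  have hm : p₀s * (ε / 4) + (∫ x, p₁s x ∂(intervalMeasure L)) * (ε / 4) = ε / 4 := by
    rw [← add_mul, hP.mass, one_mul]
  linarith

end IsDesiredState

end RepairableSystem

theorem theorem2 (lam L : ℝ) (hlam : 0 < lam) (hL : 0 < L) (p₀s : ℝ) (p₁s : ℝ → ℝ)
    (hP : RepairableSystem.IsDesiredState lam L p₀s p₁s) :
    ∃ T : ℝ≥0 → RepairableSystem.StateSpace L →L[ℝ] RepairableSystem.StateSpace L,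
      RepairableSystem.Generates (RepairableSystem.closedLoopOperator lam L p₁s) T ∧
      (∀ (t : ℝ≥0) (P : RepairableSystem.StateSpace L),
        RepairableSystem.StateNonneg P → RepairableSystem.StateNonneg (T t P)) ∧
      ∀ t : ℝ≥0, ‖T t‖ ≤ 1 := by
  open RepairableSystem in
  exact exists_generates_of_dissipative (hP.dense_domain hlam hL)
    (fun μ hμ => dissipative_of_positive
      (fun p hp => hP.totalMass_eq_zero_of_mem_graph hlam hL hp) hμ
      (hP.exists_resolvent_solution hlam hL hμ)
      fun p hp => hP.stateNonneg_of_resolvent hlam hL hμ hp)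
    (fun μ hμ => hP.exists_resolvent_solution hlam hL hμ)
    isClosed_stateNonneg stateNonneg_zero (fun _ hx _ hy => StateNonneg.add hx hy)
    (fun _ hc _ hx => StateNonneg.smul hx hc)
    (fun μ hμ p hp => hP.stateNonneg_of_resolvent hlam hL hμ hp)
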